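/- Let $N,d,K\ge 0$ be integers with $N>d+1$, let $\Sigma_x\in\mathbb R^{d\times d}$ be symmetric positive definite, let $w_m^*,w_1^*,\dots,w_K^*\in\mathbb R^d$, let $\sigma_m,\sigma_1,\dots,\sigma_K\ge 0$, and let $\lambda_1,\dots,\lambda_K\ge 0$ with $\Lambda=\sum_{k=1}^K\lambda_k$. Let $X\in\mathbb R^{N\times d}$ have i.i.d. rows distributed as $\mathcal N(0,\Sigma_x)$. For each task $t\in\{m,1,\dots,K\}$ let $Y_t=Xw_t^*+\epsilon_t$, where $\epsilon_t\in\mathbb R^N$ has i.i.d. $\mathcal N(0,\sigma_t^2)$ entries, and let $y_m=x^\top w_m^*+\epsilon$ with a fresh feature $x\sim\mathcal N(0,\Sigma_x)$ and a fresh noise $\epsilon\sim\mathcal N(0,\sigma_m^2)$; here $X,\epsilon_m,\epsilon_1,\dots,\epsilon_K,x,\epsilon$ are mutually independent. Let $\hat w_D$ be a random vector that almost surely minimizes $$w\mapsto \|Xw-Y_m\|^2+\sum_{k=1}^K\lambda_k\|Xw-Y_k\|^2$$ over $\mathbb R^d$, and let $E_K=\mathbb E\big[(x^\top\hat w_D-y_m)^2\big]$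 be the expected main-task generalization error. Then $\hat w_D$, $(x^\top\hat w_D-y_m)^2$ and $(x^\top(\hat w_D-\bar w))^2$, where $\bar w=\mathbb E[\hat w_D]$, are integrable, and $$E_K=\underbrace{\mathbb E\big[(x^\top(\hat w_D-\bar w))^2\big]}_{\text{variance}}+\underbrace{\mathbb E\big[(x^\top(\bar w-w_m^*))^2\big]}_{\text{bias}}+\underbrace{\mathbb E\big[(x^\top w_m^*-y_m)^2\big]}_{\text{noise}}.$$ If $\Lambda>0$, then, with $w^*_{\mathrm{aux}}=\frac1\Lambda\sum_{k=1}^K\lambda_kw_k^*$, the variance, bias and noise are, in this order, the three terms of $$E_K=\frac{\sigma_m^2+\sum_{k=1}^K\lambda_k^2\sigma_k^2}{(1+\Lambda)^2}\,\frac{d}{N-d-1}+\Big(\frac{\Lambda}{1+\Lambda}\Big)^2\big\|\Sigma_x^{1/2}(w^*_{\mathrm{aux}}-w_m^*)\big\|^2+\sigma_m^2 .$$ If $K=0$ or $\Lambda=0$ (only the main task is learned), the variance, bias and noise are, in this order, the three terms of $$E_0=\sigma_m^2\,\frac{d}{N-d-1}+0+\sigma_m^2 .$$ -/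

import Mathlib

open MeasureTheory ProbabilityTheory
open scoped NNReal RealInnerProductSpace MatrixOrder

noncomputable section

namespace AuxOLS

/-- A training set: shared features `X` (given by its `N` rows), the main labels and the labels of
the `K` auxiliary tasks. -/
structure TrainingSet (N d K : ℕ) where
  X : Fin N → EuclideanSpace ℝ (Fin d)
  Ym : EuclideanSpace ℝ (Fin N)
  Yaux : Fin K → EuclideanSpace ℝ (Fin N)

/-- The product `X w ∈ ℝ^N` of the matrix with rows `X i` and the vector `w`. -/
def predict {N d : ℕ} (X : Fin N → EuclideanSpace ℝ (Fin d)) (w : EuclideanSpace ℝ (Fin d)) :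
    EuclideanSpace ℝ (Fin N) :=
  WithLp.toLp 2 (Matrix.mulVec (Matrix.of fun i j => X i j) w.ofLp)

/-- Labels generated by the linear model `X w + ε`. -/
def labels {N d : ℕ} (X : Fin N → EuclideanSpace ℝ (Fin d)) (w : EuclideanSpace ℝ (Fin d))
    (ε : Fin N → ℝ) : EuclideanSpace ℝ (Fin N) :=
  predict X w + WithLp.toLp 2 ε

/-- The training set generated from the features, the true models and the label noises. -/
def generate {N d K : ℕ} (wm : EuclideanSpace ℝ (Fin d)) (waux : Fin K → EuclideanSpace ℝ (Fin d))
    (X : Fin N → EuclideanSpace ℝ (Fin d)) (εm : Fin N → ℝ) (εaux : Fin K → Fin N → ℝ) :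
    TrainingSet N d K where
  X := X
  Ym := labels X wm εm
  Yaux := fun k => labels X (waux k) (εaux k)

/-- The weighted loss `‖X w - Y_m‖² + ∑ₖ λₖ ‖X w - Yₖ‖²`. -/
def loss {N d K : ℕ} (lam : Fin K → ℝ) (D : TrainingSet N d K) (w : EuclideanSpace ℝ (Fin d)) : ℝ :=
  ‖predict D.X w - D.Ym‖ ^ 2 + ∑ k, lam k * ‖predict D.X w - D.Yaux k‖ ^ 2

/-- Joint law of (features, main noise, auxiliary noises, fresh feature, fresh noise): everything
is independent, rows of the features and the fresh feature are `N(0, S)`, and the noises of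
each task have independent entries `N(0, σ²)`, with `σ` the standard deviation of that task. -/
def jointLaw (N : ℕ) {d K : ℕ} (S : Matrix (Fin d) (Fin d) ℝ) (σm : ℝ≥0) (σaux : Fin K → ℝ≥0) :
    Measure ((Fin N → EuclideanSpace ℝ (Fin d)) × (Fin N → ℝ) × (Fin K → Fin N → ℝ) ×
      EuclideanSpace ℝ (Fin d) × ℝ) :=
  (Measure.pi fun _ : Fin N => multivariateGaussian 0 S).prod <|
    (Measure.pi fun _ : Fin N => gaussianReal 0 (σm ^ 2)).prod <|
      (Measure.pi fun k : Fin K => Measure.pi fun _ : Fin N => gaussianReal 0 (σaux k ^ 2)).prod <|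
        (multivariateGaussian 0 S).prod (gaussianReal 0 (σm ^ 2))

variable {Ω : Type*} [MeasurableSpace Ω] {d : ℕ}

/-- Expected generalization error `𝔼 (xᵀ ŵ - y)²` of the random estimator `ŵ`. -/
def genError (P : Measure Ω) (what x : Ω → EuclideanSpace ℝ (Fin d)) (y : Ω → ℝ) : ℝ :=
  ∫ ω, (⟪x ω, what ω⟫ - y ω) ^ 2 ∂P

/-- Variance `𝔼 (xᵀ (ŵ - 𝔼 ŵ))²`. -/
def varianceTerm (P : Measure Ω) (what x : Ω → EuclideanSpace ℝ (Fin d)) : ℝ :=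
  ∫ ω, ⟪x ω, what ω - ∫ ω', what ω' ∂P⟫ ^ 2 ∂P

/-- Bias `𝔼 (xᵀ (𝔼 ŵ - w_m))²`. -/
def biasTerm (P : Measure Ω) (what x : Ω → EuclideanSpace ℝ (Fin d))
    (wm : EuclideanSpace ℝ (Fin d)) : ℝ :=
  ∫ ω, ⟪x ω, (∫ ω', what ω' ∂P) - wm⟫ ^ 2 ∂P

/-- Noise `𝔼 (xᵀ w_m - y)²`. -/
def noiseTerm (P : Measure Ω) (x : Ω → EuclideanSpace ℝ (Fin d)) (y : Ω → ℝ)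
    (wm : EuclideanSpace ℝ (Fin d)) : ℝ :=
  ∫ ω, (⟪x ω, wm⟫ - y ω) ^ 2 ∂P

/-- The vector `S^{1/2} v`, with the positive semidefinite square root of `S`. -/
def sqrtApply (S : Matrix (Fin d) (Fin d) ℝ) (v : EuclideanSpace ℝ (Fin d)) :
    EuclideanSpace ℝ (Fin d) :=
  Matrix.toEuclideanCLM (𝕜 := ℝ) (CFC.sqrt S) v

end AuxOLS

end

/-! All tasks share the features, so the normal equation of the weighted loss is that of a single
least squares problem with averaged labels. Off the null event where `XᵀX` is singular, the
minimizer is `w₀ + A η`, with `A = (XᵀX)⁻¹Xᵀ`, `w₀ = (w_m + ∑ λₖ wₖ) / (1 + Λ)` and pooled noise `η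
= (ε_m + ∑ λₖ εₖ) / (1 + Λ)` (`isMinOn_loss_generate_apply`).

Since `η` is centred and independent of `X`, the mean of the estimator is `w₀`, and `w₀ - w_m =
Λ/(1+Λ) (w_aux - w_m)` gives the bias. The fresh noise is centred and independent of the rest, so
all cross terms vanish (`risk_decomposition`).

The covariance of `η` is `τ I` with `τ = (σ_m² + ∑ λₖ² σₖ²) / (1 + Λ)²`, so the variance is `τ 𝔼
tr(S A Aᵀ)`. Writing `X = C S^{1/2}` with `C` standard Gaussian turns this into `τ 𝔼 tr((CᵀC)⁻¹)`. A
diagonal entry of `(CᵀC)⁻¹` is the inverse squared distance of a column to the span of the other `d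
- 1` columns (`inv_gram_apply_self`). Given those columns, the squared distance is chi-squared with
`N - d + 1` degrees of freedom, and its inverse has mean `1 / (N - d - 1)`. Summing `d` entries
gives `d / (N - d - 1)`; finiteness of this mean also supplies every integrability claim about `A`.
-/

namespace AuxOLS

/-! ### Inverse chi-squared moments and projections of standard Gaussian vectors. -/

section Gaussian

open Module

lemma integral_exp_neg_mul_sq_gaussianReal {t : ℝ} (ht : 0 ≤ t) :
    ∫ x, Real.exp (-t * x ^ 2) ∂gaussianReal 0 1 = (1 + 2 * t) ^ (-(1 / 2) : ℝ) := by
  rw [integral_gaussianReal_eq_integral_smul one_ne_zero]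
  have h (x : ℝ) : gaussianPDFReal 0 1 x • Real.exp (-t * x ^ 2) =
      (√(2 * Real.pi))⁻¹ * Real.exp (-(t + 1 / 2) * x ^ 2) := by
    simp only [gaussianPDFReal, smul_eq_mul, NNReal.coe_one, mul_one, sub_zero, mul_assoc,
      ← Real.exp_add]
    ring_nf
  simp_rw [h, integral_const_mul, integral_gaussian]
  rw [← Real.sqrt_inv, ← Real.sqrt_mul (by positivity), Real.rpow_neg (by positivity),
    ← Real.sqrt_eq_rpow, ← Real.sqrt_inv]
  congr 1
  have : t + 1 / 2 ≠ 0 := by positivity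
  have : 1 + 2 * t ≠ 0 := by positivity
  have := Real.pi_ne_zero
  field_simp
  ring

variable {E : Type*} [NormedAddCommGroup E] [InnerProductSpace ℝ E] [FiniteDimensional ℝ E]
  [MeasurableSpace E] [BorelSpace E]

/-- In an orthonormal basis the squared norm is a sum of squares of independent standard Gaussians,
so its Laplace transform factors. -/
lemma integral_exp_neg_mul_norm_sq_stdGaussian {t : ℝ} (ht : 0 ≤ t) :
    ∫ g, Real.exp (-t * ‖g‖ ^ 2) ∂stdGaussian E =
      (1 + 2 * t) ^ (-(finrank ℝ E / 2 : ℝ)) := by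
  let b := stdOrthonormalBasis ℝ E
  rw [stdGaussian_eq_map_pi_orthonormalBasis b,
    integral_map (Measurable.aemeasurable (by fun_prop))
      (Measurable.aestronglyMeasurable (by fun_prop))]
  have h (x : Fin (finrank ℝ E) → ℝ) : Real.exp (-t * ‖∑ i, x i • b i‖ ^ 2) =
      ∏ i, Real.exp (-t * x i ^ 2) := by
    rw [← Real.exp_sum, ← Finset.mul_sum, ← real_inner_self_eq_norm_sq,
      b.orthonormal.inner_sum]
    simp [sq]
  simp_rw [h]
  rw [integral_fintype_prod_eq_prod (f := fun _ x => Real.exp (-t * x ^ 2))]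
  simp only [integral_exp_neg_mul_sq_gaussianReal ht, Finset.prod_const, Finset.card_univ,
    Fintype.card_fin]
  rw [← Real.rpow_natCast, ← Real.rpow_mul (by positivity)]
  ring_nf

lemma lintegral_Ioi_exp_neg_mul {a : ℝ} (ha : 0 ≤ a) :
    ∫⁻ t in Set.Ioi (0 : ℝ), ENNReal.ofReal (Real.exp (-t * a)) = (ENNReal.ofReal a)⁻¹ := by
  rcases ha.eq_or_lt with rfl | ha
  · simp
  have h (t : ℝ) : -t * a = -a * t := by ring
  simp_rw [h]
  rw [← ofReal_integral_eq_lintegral_ofReal (integrableOn_exp_mul_Ioi (by linarith) 0)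
    (ae_of_all _ fun _ => by positivity), integral_exp_mul_Ioi (by linarith),
    ← ENNReal.ofReal_inv_of_pos ha]
  simp

/-- The antiderivative has exponent `1 - p / 2`, negative exactly when `2 < p`, so its boundary term
at infinity vanishes. -/
lemma lintegral_Ioi_one_add_two_mul_rpow {p : ℝ} (hp : 2 < p) :
    ∫⁻ t in Set.Ioi (0 : ℝ), ENNReal.ofReal ((1 + 2 * t) ^ (-(p / 2))) =
      ENNReal.ofReal (1 / (p - 2)) := by
  have hderiv : ∀ t ∈ Set.Ici (0 : ℝ), HasDerivAt
      (fun t : ℝ => -(1 / (p - 2)) * (1 + 2 * t) ^ (1 - p / 2)) ((1 + 2 * t) ^ (-(p / 2))) t := by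
    intro t ht
    have ht : (0 : ℝ) ≤ t := ht
    have h1 : HasDerivAt (fun t : ℝ => 1 + 2 * t) 2 t := by
      simpa using ((hasDerivAt_id t).const_mul 2).const_add 1
    convert! (h1.rpow_const (p := 1 - p / 2) (Or.inl (by positivity))).const_mul
      (-(1 / (p - 2))) using 1
    have : p - 2 ≠ 0 := by linarith
    rw [show 1 - p / 2 - 1 = -(p / 2) by ring]
    field_simp
    ring
  have hpos : ∀ t ∈ Set.Ioi (0 : ℝ), 0 ≤ (1 + 2 * t) ^ (-(p / 2)) := fun t ht => by
    have : (0 : ℝ) < t := ht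
    positivity
  have htend : Filter.Tendsto (fun t : ℝ => -(1 / (p - 2)) * (1 + 2 * t) ^ (1 - p / 2))
      Filter.atTop (nhds 0) := by
    have h1 : Filter.Tendsto (fun t : ℝ => 1 + 2 * t) Filter.atTop Filter.atTop :=
      Filter.tendsto_atTop_add_const_left _ _
        (Filter.tendsto_id.const_mul_atTop (by norm_num : (0 : ℝ) < 2))
    have h2 := ((tendsto_rpow_neg_atTop (y := p / 2 - 1) (by linarith)).comp h1).const_mul
      (-(1 / (p - 2)))
    simpa using h2
  rw [← ofReal_integral_eq_lintegral_ofReal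
    (integrableOn_Ioi_deriv_of_nonneg' hderiv hpos htend)
    (ae_restrict_of_forall_mem measurableSet_Ioi hpos),
    integral_Ioi_of_hasDerivAt_of_nonneg' hderiv hpos htend]
  simp

/-- The inverse of a chi-squared variable with `n` degrees of freedom has mean `1 / (n - 2)`. -/
lemma lintegral_inv_norm_sq_stdGaussian (hE : 2 < finrank ℝ E) :
    ∫⁻ g, (ENNReal.ofReal (‖g‖ ^ 2))⁻¹ ∂stdGaussian E =
      ENNReal.ofReal (1 / ((finrank ℝ E : ℝ) - 2)) := by
  -- Write `1 / a` as the integral of `exp (-t a)` over `t > 0` and apply Tonelli: the inner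
  -- integral becomes the Laplace transform of `‖g‖²`.
  simp_rw [← lintegral_Ioi_exp_neg_mul (sq_nonneg ‖_‖)]
  rw [lintegral_lintegral_swap (Measurable.aemeasurable (by fun_prop)),
    ← lintegral_Ioi_one_add_two_mul_rpow (by exact_mod_cast hE)]
  refine setLIntegral_congr_fun measurableSet_Ioi fun t ht => ?_
  have ht : (0 : ℝ) < t := ht
  rw [← integral_exp_neg_mul_norm_sq_stdGaussian ht.le, ofReal_integral_eq_lintegral_ofReal _
    (ae_of_all _ fun _ => by positivity)]
  refine Integrable.of_bound (Measurable.aestronglyMeasurable (by fun_prop)) 1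
    (ae_of_all _ fun g => ?_)
  rw [Real.norm_eq_abs, Real.abs_exp, Real.exp_le_one_iff]
  have := mul_nonneg ht.le (sq_nonneg ‖g‖)
  linarith

/-- For `t ∈ V`, pairing with `t` does not see the projection, so the two characteristic functions
agree. -/
lemma map_orthogonalProjection_stdGaussian (V : Submodule ℝ E) :
    (stdGaussian E).map V.orthogonalProjectionOnto = stdGaussian V := by
  apply Measure.ext_of_charFun
  ext t
  rw [charFun_stdGaussian, charFun_apply, integral_map (by fun_prop)
    (Measurable.aestronglyMeasurable (by fun_prop))]
  simp_rw [Submodule.inner_orthogonalProjectionOnto_eq_of_mem_right]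
  rw [← charFun_apply, charFun_stdGaussian]
  rfl

lemma lintegral_inv_norm_sq_orthogonalProjection_stdGaussian (V : Submodule ℝ E)
    (hV : 2 < finrank ℝ V) :
    ∫⁻ g, (ENNReal.ofReal (‖V.orthogonalProjectionOnto g‖ ^ 2))⁻¹ ∂stdGaussian E =
      ENNReal.ofReal (1 / ((finrank ℝ V : ℝ) - 2)) := by
  rw [← lintegral_inv_norm_sq_stdGaussian hV, ← map_orthogonalProjection_stdGaussian,
    lintegral_map (by fun_prop) (by fun_prop)]

/-- A proper subspace lies in the hyperplane orthogonal to some `v ≠ 0`, and `⟪v, g⟫` is Gaussian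
with variance `‖v‖² > 0`, hence has no atom at zero. -/
lemma stdGaussian_submodule_eq_zero {V : Submodule ℝ E} (hV : V ≠ ⊤) :
    stdGaussian E (V : Set E) = 0 := by
  obtain ⟨v, hv, hv0⟩ := Submodule.exists_mem_ne_zero_of_ne_bot
    (mt V.orthogonal_eq_bot_iff.1 hV)
  have hsub : (V : Set E) ⊆ innerSL ℝ v ⁻¹' {0} := fun g hg => by
    simpa [real_inner_comm] using hv g hg
  refine measure_mono_null hsub ?_
  rw [← Measure.map_apply (by fun_prop) (measurableSet_singleton 0),
    IsGaussian.map_eq_gaussianReal, variance_dual_stdGaussian, innerSL_apply_norm]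
  have : NullSingletonClass (gaussianReal ((stdGaussian E)[innerSL ℝ v]) (‖v‖ ^ 2).toNNReal) :=
    nullSingletonClass_gaussianReal (by simp [hv0])
  exact measure_singleton 0

end Gaussian

/-! ### Inverse Gram matrices of standard Gaussian vectors. -/

section Gram

open Module Matrix

section Measurability

variable {α n : Type*} [MeasurableSpace α] [Fintype n] [DecidableEq n]

lemma measurable_det {f : α → Matrix n n ℝ} (hf : ∀ i j, Measurable fun a => f a i j) :
    Measurable fun a => (f a).det := by
  simp only [det_apply]
  fun_prop

/-- By the adjugate formula each entry is a quotient of polynomials in the entries of the matrix;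
the value zero at singular matrices matches division by zero. -/
lemma measurable_inv_apply {f : α → Matrix n n ℝ} (hf : ∀ i j, Measurable fun a => f a i j)
    (i j : n) : Measurable fun a => (f a)⁻¹ i j := by
  simp only [inv_def, Ring.inverse_eq_inv', Matrix.smul_apply, smul_eq_mul, adjugate_apply]
  refine (measurable_det hf).inv.mul (measurable_det fun k l => ?_)
  by_cases hk : k = j
  · subst hk; simp
  · simpa [updateRow_ne hk] using hf k l

end Measurability

variable {E : Type*} [NormedAddCommGroup E] [InnerProductSpace ℝ E]

/-- The diagonal entries of the inverse Gram matrix are the inverse squared distances from each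
vector to the span of the others. -/
lemma inv_gram_apply_self [FiniteDimensional ℝ E] {n : ℕ} {c : Fin (n + 1) → E}
    (hc : LinearIndependent ℝ c) (j : Fin (n + 1)) {V : Submodule ℝ E}
    (hV : V = Submodule.span ℝ (Set.range fun k => c (j.succAbove k))) :
    (gram ℝ c)⁻¹ j j = (‖Vᗮ.orthogonalProjectionOnto (c j)‖ ^ 2)⁻¹ := by
  set r : Vᗮ := Vᗮ.orthogonalProjectionOnto (c j) with hr
  have hdet : IsUnit (gram ℝ c).det :=
    isUnit_iff_ne_zero.2 (det_gram_ne_zero_iff_linearIndependent.2 hc)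
  have hmem : c j - (r : E) ∈ V := by
    have h2 : (r : E) = c j - V.starProjection (c j) := by
      rw [hr, ← Submodule.starProjection_apply, Submodule.starProjection_orthogonal_val]
    rw [h2, sub_sub_cancel]
    exact Submodule.starProjection_apply_mem V (c j)
  obtain ⟨b, hb⟩ := (Submodule.mem_span_range_iff_exists_fun ℝ).1 (hV.le hmem)
  -- The coefficients of the residual `r = c j - ∑ b k • c (j.succAbove k)`. As `r` is orthogonal to
  -- all `c i` with `i ≠ j`, the Gram matrix sends `a` to `‖r‖²` times the `j`-th basis vector;
  -- entry `j` of `a`, which is `1`, then yields the formula.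
  let a : Fin (n + 1) → ℝ := j.insertNth 1 (fun k => -b k)
  have ha : ∑ i, a i • c i = (r : E) := by
    rw [Fin.sum_univ_succAbove _ j]
    simp [a, hb]
  have horth (v : E) (hv : v ∈ V) : ⟪v, (r : E)⟫ = 0 := r.2 v hv
  have hmul : gram ℝ c *ᵥ a = ‖r‖ ^ 2 • Pi.single j 1 := by
    ext i
    have h1 : (gram ℝ c *ᵥ a) i = ⟪c i, (r : E)⟫ := by
      simp [← ha, inner_sum, mulVec, dotProduct, inner_smul_right, mul_comm]
    rw [h1]
    rcases Fin.eq_self_or_eq_succAbove j i with rfl | ⟨k, rfl⟩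
    · have := horth _ hmem
      rw [inner_sub_left, sub_eq_zero, real_inner_self_eq_norm_sq] at this
      simp [this]
    · rw [horth _ (hV ▸ Submodule.subset_span ⟨k, rfl⟩)]
      simp [Fin.succAbove_ne]
  have h1 : a = (gram ℝ c)⁻¹ *ᵥ (‖r‖ ^ 2 • Pi.single j 1) := by
    rw [← hmul, mulVec_mulVec, nonsing_inv_mul _ hdet, one_mulVec]
  have h2 := congrFun h1 j
  rw [mulVec_smul] at h2
  simp only [a, Fin.insertNth_apply_same, Pi.smul_apply, smul_eq_mul, mulVec_single_one] at h2
  exact eq_inv_of_mul_eq_one_right h2.symm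

variable [FiniteDimensional ℝ E] [MeasurableSpace E] [BorelSpace E]

lemma measurableSet_linearIndependent (n : ℕ) :
    MeasurableSet {c : Fin n → E | LinearIndependent ℝ c} := by
  simp_rw [← det_gram_ne_zero_iff_linearIndependent (𝕜 := ℝ)]
  exact (measurableSet_singleton (0 : ℝ)).compl.preimage
    (measurable_det fun i j => by simp only [gram_apply]; fun_prop)

/-- Fubini with the `j`-th vector innermost, so that it can be treated as random while the others
are frozen. -/
lemma ae_linearIndependent_pi_succ_iff {n : ℕ} (μ : Measure E) [SigmaFinite μ] (j : Fin (n + 1)) :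
    (∀ᵐ c ∂(Measure.pi fun _ : Fin (n + 1) => μ), LinearIndependent ℝ c) ↔
      ∀ᵐ c ∂(Measure.pi fun _ : Fin n => μ), ∀ᵐ g ∂μ,
        LinearIndependent ℝ (j.insertNth g c : Fin (n + 1) → E) := by
  have hmp := (measurePreserving_piFinSuccAbove (fun _ : Fin (n + 1) => μ) j).symm
  have hmeas := hmp.measurable (measurableSet_linearIndependent (E := E) (n + 1))
  rw [← hmp.map_eq, ae_map_iff hmp.measurable.aemeasurable (measurableSet_linearIndependent _)]
  exact (Measure.ae_prod_iff_ae_ae hmeas).trans (Measure.ae_ae_comm hmeas)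

/-- Fewer vectors than the dimension span a proper subspace, which an independent Gaussian vector
almost surely avoids. -/
lemma ae_linearIndependent_stdGaussian {n : ℕ} (hn : n ≤ finrank ℝ E) :
    ∀ᵐ c ∂(Measure.pi fun _ : Fin n => stdGaussian E), LinearIndependent ℝ c := by
  induction n with
  | zero => exact ae_of_all _ fun c => linearIndependent_empty_type
  | succ n ih =>
    rw [ae_linearIndependent_pi_succ_iff _ 0]
    filter_upwards [ih (by omega)] with c hc
    have hV : Submodule.span ℝ (Set.range c) ≠ ⊤ := fun h => by
      have := finrank_span_eq_card hc
      rw [h, finrank_top, Fintype.card_fin] at this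
      omega
    filter_upwards [measure_eq_zero_iff_ae_notMem.1 (stdGaussian_submodule_eq_zero hV)] with g hg
    rw [Fin.insertNth_zero']
    exact linearIndependent_finCons.2 ⟨hc, hg⟩

/-- With the other `n` vectors fixed, the entry is the inverse squared norm of a Gaussian vector
projected to a space of dimension `finrank ℝ E - n`, so its conditional mean is constant. The lower
integral makes integrability a consequence rather than a prerequisite. -/
lemma lintegral_inv_gram_apply_self {n : ℕ} (hn : n + 2 < finrank ℝ E) (j : Fin (n + 1)) :
    ∫⁻ c, ENNReal.ofReal ((gram ℝ c)⁻¹ j j) ∂(Measure.pi fun _ : Fin (n + 1) => stdGaussian E) =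
      ENNReal.ofReal (1 / ((finrank ℝ E : ℝ) - n - 2)) := by
  have hmp := (measurePreserving_piFinSuccAbove (fun _ : Fin (n + 1) => stdGaussian E) j).symm
  have hmeas : Measurable fun c : Fin (n + 1) → E => ENNReal.ofReal ((gram ℝ c)⁻¹ j j) :=
    (measurable_inv_apply (fun i j => by simp only [gram_apply]; fun_prop) j j).ennreal_ofReal
  have hae := ae_linearIndependent_stdGaussian (E := E) (n := n + 1) (by omega)
  rw [ae_linearIndependent_pi_succ_iff _ j] at hae
  rw [← hmp.map_eq, lintegral_map hmeas hmp.measurable]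
  refine (lintegral_prod_symm' _ (hmeas.comp hmp.measurable)).trans ?_
  calc _ = ∫⁻ _ : Fin n → E, ENNReal.ofReal (1 / ((finrank ℝ E : ℝ) - n - 2))
        ∂(Measure.pi fun _ => stdGaussian E) := by
        refine lintegral_congr_ae ?_
        filter_upwards [hae, ae_linearIndependent_stdGaussian (E := E) (n := n) (by omega)]
          with c hc hli
        have hrank : finrank ℝ (Submodule.span ℝ (Set.range c))ᗮ + n = finrank ℝ E := by
          have h1 := finrank_span_eq_card hli
          have h2 := Submodule.finrank_add_finrank_orthogonal (Submodule.span ℝ (Set.range c))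
          rw [h1, Fintype.card_fin] at h2
          omega
        have hr : ((finrank ℝ (Submodule.span ℝ (Set.range c))ᗮ : ℕ) : ℝ) =
            (finrank ℝ E : ℝ) - n := by rw [← hrank]; push_cast; ring
        rw [← hr, ← lintegral_inv_norm_sq_orthogonalProjection_stdGaussian _ (by omega)]
        refine lintegral_congr_ae ?_
        filter_upwards [hc, measure_eq_zero_iff_ae_notMem.1 (stdGaussian_submodule_eq_zero
          (V := Submodule.span ℝ (Set.range c)) (fun h => by
            rw [h, Submodule.top_orthogonal_eq_bot, finrank_bot] at hrank; omega))] with g hg hgV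
        have hins := inv_gram_apply_self hg j (V := Submodule.span ℝ (Set.range c)) (by simp)
        rw [Fin.insertNth_apply_same] at hins
        change ENNReal.ofReal ((gram ℝ (j.insertNth g c : Fin (n + 1) → E))⁻¹ j j) = _
        rw [hins, ENNReal.ofReal_inv_of_pos]
        have : (Submodule.span ℝ (Set.range c))ᗮ.orthogonalProjectionOnto g ≠ 0 := fun h => by
          rw [Submodule.orthogonalProjectionOnto_eq_zero_iff,
            Submodule.orthogonal_orthogonal] at h
          exact hgV h
        positivity
    _ = _ := by simp

/-- The trace of the inverse of a standard Wishart matrix with `N` degrees of freedom and dimension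
`d` has mean `d / (N - d - 1)`. -/
lemma integral_trace_inv_gram_stdGaussian {d : ℕ} (hd : d + 1 < finrank ℝ E) :
    (∀ j, Integrable (fun c => (gram ℝ c)⁻¹ j j) (Measure.pi fun _ : Fin d => stdGaussian E)) ∧
    ∫ c, ((gram ℝ c)⁻¹).trace ∂(Measure.pi fun _ : Fin d => stdGaussian E) =
      d / ((finrank ℝ E : ℝ) - d - 1) := by
  rcases d with _ | n
  · simp
  have hnonneg (c : Fin (n + 1) → E) (j) : 0 ≤ (gram ℝ c)⁻¹ j j :=
    (posSemidef_gram ℝ c).inv.diag_nonneg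
  have hmeas (j) : Measurable fun c : Fin (n + 1) → E => (gram ℝ c)⁻¹ j j :=
    measurable_inv_apply (fun i j => by simp only [gram_apply]; fun_prop) j j
  have hint (j) : Integrable (fun c => (gram ℝ c)⁻¹ j j)
      (Measure.pi fun _ : Fin (n + 1) => stdGaussian E) := by
    refine ⟨(hmeas j).aestronglyMeasurable, ?_⟩
    rw [hasFiniteIntegral_iff_ofReal (ae_of_all _ fun c => hnonneg c j),
      lintegral_inv_gram_apply_self (by omega)]
    exact ENNReal.ofReal_lt_top
  have hpos : (0 : ℝ) < (finrank ℝ E : ℝ) - n - 2 := by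
    have : ((n + 1 + 1 : ℕ) : ℝ) < finrank ℝ E := by exact_mod_cast hd
    push_cast at this
    linarith
  refine ⟨hint, ?_⟩
  simp only [trace, diag_apply]
  rw [integral_finsetSum _ fun j _ => hint j]
  simp_rw [integral_eq_lintegral_of_nonneg_ae (ae_of_all _ fun c => hnonneg c _)
    (hmeas _).aestronglyMeasurable]
  simp_rw [lintegral_inv_gram_apply_self (by omega : n + 2 < finrank ℝ E)]
  rw [ENNReal.toReal_ofReal (by positivity)]
  simp only [Finset.sum_const, Finset.card_univ, Fintype.card_fin, nsmul_eq_mul]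
  push_cast
  -- Here `d = n + 1`: each column is projected away from only `d - 1` others, and the chi-squared
  -- mean costs another `2`.
  rw [show (finrank ℝ E : ℝ) - (n + 1) - 1 = finrank ℝ E - n - 2 by ring]
  ring

end Gram

/-! ### Normal equation and closed form of the minimizer. -/

section LeastSquares

open Matrix

/-- The matrix with rows `X i`. -/
def design {N d : ℕ} (X : Fin N → EuclideanSpace ℝ (Fin d)) : Matrix (Fin N) (Fin d) ℝ :=
  of fun i j => X i j

/-- The matrix `(XᵀX)⁻¹Xᵀ` of the ordinary least squares estimator. -/
noncomputable def olsMatrix {N d : ℕ} (X : Fin N → EuclideanSpace ℝ (Fin d)) :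
    Matrix (Fin d) (Fin N) ℝ :=
  ((design X)ᵀ * design X)⁻¹ * (design X)ᵀ

variable {N d K : ℕ}

lemma measurable_olsMatrix_apply (j : Fin d) (i : Fin N) :
    Measurable fun X : Fin N → EuclideanSpace ℝ (Fin d) => olsMatrix X j i := by
  simp only [olsMatrix, mul_apply, transpose_apply, design, of_apply]
  refine Finset.measurable_sum _ fun k _ => (measurable_inv_apply (fun a b => ?_) j k).mul
    (by fun_prop)
  simp only [mul_apply, transpose_apply, of_apply]
  fun_prop

lemma predict_add_smul (X : Fin N → EuclideanSpace ℝ (Fin d)) (w v : EuclideanSpace ℝ (Fin d))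
    (t : ℝ) : predict X (w + t • v) = predict X w + t • predict X v := by
  ext i
  simp [predict, mulVec_add, mulVec_smul]

/-- Along a line the loss is an exact quadratic; its linear coefficient is the directional
derivative, which must vanish at a minimizer. -/
lemma loss_add_smul_sub (lam : Fin K → ℝ) (D : TrainingSet N d K)
    (w v : EuclideanSpace ℝ (Fin d)) (t : ℝ) :
    loss lam D (w + t • v) - loss lam D w =
      (1 + ∑ k, lam k) * ‖predict D.X v‖ ^ 2 * t ^ 2 +
      2 * ⟪predict D.X v, (1 + ∑ k, lam k) • predict D.X w - D.Ym - ∑ k, lam k • D.Yaux k⟫ * t := by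
  have h (a b y : EuclideanSpace ℝ (Fin N)) : ‖a + t • b - y‖ ^ 2 - ‖a - y‖ ^ 2 =
      ‖b‖ ^ 2 * t ^ 2 + 2 * ⟪b, a - y⟫ * t := by
    rw [add_sub_right_comm, norm_add_sq_real, norm_smul, inner_smul_right, mul_pow,
      Real.norm_eq_abs, sq_abs, real_inner_comm]
    ring
  have hsub : (1 + ∑ k, lam k) • predict D.X w - D.Ym - ∑ k, lam k • D.Yaux k =
      (predict D.X w - D.Ym) + ∑ k, lam k • (predict D.X w - D.Yaux k) := by
    simp only [smul_sub, Finset.sum_sub_distrib, ← Finset.sum_smul, add_smul, one_smul]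
    abel
  rw [loss, loss, predict_add_smul, add_sub_add_comm, h, ← Finset.sum_sub_distrib, hsub]
  simp_rw [← mul_sub, h, inner_add_right, inner_sum, inner_smul_right]
  simp only [mul_add, add_mul, Finset.sum_add_distrib, Finset.sum_mul, Finset.mul_sum]
  simp only [mul_assoc, mul_left_comm]
  ring

lemma eq_zero_of_forall_quadratic_nonneg {a b : ℝ} (h : ∀ t : ℝ, 0 ≤ a * t ^ 2 + b * t) :
    b = 0 := by
  have := discrim_le_zero (K := ℝ) (a := a) (b := b) (c := 0) fun t => by
    have := h t
    nlinarith
  simp only [discrim, mul_zero, sub_zero] at this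
  exact pow_eq_zero_iff two_ne_zero |>.1 (le_antisymm this (sq_nonneg b))

/-- The normal equation of the weighted least squares problem. -/
lemma transpose_mulVec_eq_zero_of_isMinOn {lam : Fin K → ℝ} {D : TrainingSet N d K}
    {w : EuclideanSpace ℝ (Fin d)} (hw : IsMinOn (loss lam D) Set.univ w) :
    (design D.X)ᵀ *ᵥ
      ((1 + ∑ k, lam k) • predict D.X w - D.Ym - ∑ k, lam k • D.Yaux k).ofLp = 0 := by
  set r := (1 + ∑ k, lam k) • predict D.X w - D.Ym - ∑ k, lam k • D.Yaux k with hr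
  ext j
  have h := eq_zero_of_forall_quadratic_nonneg
    (a := (1 + ∑ k, lam k) * ‖predict D.X (EuclideanSpace.single j 1)‖ ^ 2)
    (b := 2 * ⟪predict D.X (EuclideanSpace.single j 1), r⟫) fun t => by
      rw [hr, ← loss_add_smul_sub]
      exact sub_nonneg.2 (isMinOn_iff.1 hw _ (Set.mem_univ _))
  have h2 : ⟪predict D.X (EuclideanSpace.single j 1), r⟫ = 0 := by linarith
  rw [Pi.zero_apply, ← h2]
  simp [predict, mulVec, dotProduct, design, PiLp.inner_apply, mul_comm]

/-- After substituting the linear models, the pooled residual is `(1 + Λ) (X (w - w₀) - η)`; the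
normal equation becomes `XᵀX (w - w₀) = Xᵀ η`, which is then inverted. -/
lemma isMinOn_loss_generate_apply {lam : Fin K → ℝ} (hlam : ∀ k, 0 ≤ lam k)
    {wm : EuclideanSpace ℝ (Fin d)} {waux : Fin K → EuclideanSpace ℝ (Fin d)}
    {X : Fin N → EuclideanSpace ℝ (Fin d)} {εm : Fin N → ℝ} {εaux : Fin K → Fin N → ℝ}
    {w : EuclideanSpace ℝ (Fin d)} (hX : ((design X)ᵀ * design X).det ≠ 0)
    (hw : IsMinOn (loss lam (generate wm waux X εm εaux)) Set.univ w) (j : Fin d) :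
    w j = ((1 + ∑ k, lam k)⁻¹ • (wm + ∑ k, lam k • waux k)) j +
      ∑ i, olsMatrix X j i * ((1 + ∑ k, lam k)⁻¹ * (εm i + ∑ k, lam k * εaux k i)) := by
  set L := ∑ k, lam k
  have hL : 1 + L ≠ 0 := by
    have : 0 ≤ L := Finset.sum_nonneg fun k _ => hlam k
    positivity
  set w0 : Fin d → ℝ := (1 + L)⁻¹ • (wm.ofLp + ∑ k, lam k • (waux k).ofLp)
  set η : Fin N → ℝ := fun i => (1 + L)⁻¹ * (εm i + ∑ k, lam k * εaux k i)
  have hne := transpose_mulVec_eq_zero_of_isMinOn hw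
  have hr : ((1 + L) • predict X w - labels X wm εm -
      ∑ k, lam k • labels X (waux k) (εaux k)).ofLp =
      (1 + L) • (design X *ᵥ (w.ofLp - w0) - η) := by
    have h1 : (1 + L) • w0 = wm.ofLp + ∑ k, lam k • (waux k).ofLp := by
      simp [w0, smul_smul, hL]
    have h2 : (1 + L) • η = εm + ∑ k, lam k • εaux k := by
      ext i; simp [η, hL]
    rw [smul_sub, ← mulVec_smul, smul_sub, h1, h2, mulVec_sub, mulVec_add, mulVec_smul,
      mulVec_sum]
    simp only [mulVec_smul, predict, labels, WithLp.ofLp_sub, WithLp.ofLp_smul, WithLp.ofLp_add,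
      WithLp.ofLp_sum, smul_add, Finset.sum_add_distrib]
    simp only [design]
    abel
  change (design X)ᵀ *ᵥ ((1 + L) • predict X w - labels X wm εm -
      ∑ k, lam k • labels X (waux k) (εaux k)).ofLp = 0 at hne
  rw [hr, mulVec_smul, smul_eq_zero_iff_right hL, mulVec_sub, mulVec_mulVec, sub_eq_zero] at hne
  have hsol : w.ofLp - w0 = olsMatrix X *ᵥ η := by
    rw [olsMatrix, ← mulVec_mulVec, ← hne, mulVec_mulVec,
      nonsing_inv_mul _ (isUnit_iff_ne_zero.2 hX), one_mulVec]
  have := congrFun hsol j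
  simp only [Pi.sub_apply, sub_eq_iff_eq_add', mulVec, dotProduct] at this
  simpa [w0, η] using this

end LeastSquares

/-! ### Whitening of the Gaussian design and second moments of the least squares matrix. -/

section RandomDesign

open Matrix

lemma map_curry_pi {ι κ α : Type*} [Fintype ι] [Fintype κ] [MeasurableSpace α]
    (μ : Measure α) [IsProbabilityMeasure μ] :
    (Measure.pi fun _ : ι × κ => μ).map (fun x i j => x (i, j)) =
      Measure.pi fun _ : ι => Measure.pi fun _ : κ => μ := by
  simp_rw [← Measure.infinitePi_eq_pi]
  exact Measure.infinitePi_map_curry (fun (_ : ι) (_ : κ) => μ)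

/-- Lets an i.i.d. matrix be read either by rows, the samples, or by columns, the vectors of the
Gram matrix. -/
lemma map_swap_pi_pi {ι κ α : Type*} [Fintype ι] [Fintype κ] [MeasurableSpace α]
    (μ : Measure α) [IsProbabilityMeasure μ] :
    (Measure.pi fun _ : ι => Measure.pi fun _ : κ => μ).map (fun x j i => x i j) =
      Measure.pi fun _ : κ => Measure.pi fun _ : ι => μ := by
  rw [← map_curry_pi, ← map_curry_pi (ι := κ),
    ← Measure.pi_map_piCongrLeft (Equiv.prodComm ι κ), Measure.map_map (by fun_prop) (by fun_prop),
    Measure.map_map (by fun_prop) (by fun_prop)]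
  rfl

/-- The rows of the matrix `C S^{1/2}`, where `C` has columns `c j`. -/
noncomputable def colored {N d : ℕ} (S : Matrix (Fin d) (Fin d) ℝ)
    (c : Fin d → EuclideanSpace ℝ (Fin N)) : Fin N → EuclideanSpace ℝ (Fin d) :=
  fun i => toEuclideanCLM (𝕜 := ℝ) (CFC.sqrt S) (WithLp.toLp 2 fun j => c j i)

variable {N d : ℕ} {S : Matrix (Fin d) (Fin d) ℝ}

lemma measurable_colored : Measurable (colored (N := N) S) := by
  unfold colored
  fun_prop

lemma map_colored_pi_stdGaussian :
    (Measure.pi fun _ : Fin d => stdGaussian (EuclideanSpace ℝ (Fin N))).map (colored S) =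
      Measure.pi fun _ : Fin N => multivariateGaussian 0 S := by
  simp_rw [multivariateGaussian, ← map_pi_eq_stdGaussian]
  rw [Measure.map_map (by fun_prop) (by fun_prop),
    ← Measure.pi_map_pi (hf := fun _ => Measurable.aemeasurable (by fun_prop)),
    ← Measure.pi_map_pi (hf := fun _ => Measurable.aemeasurable (by fun_prop)),
    ← map_swap_pi_pi (ι := Fin d), Measure.map_map measurable_colored (by fun_prop),
    Measure.map_map (by fun_prop) (by fun_prop)]
  congr 1
  ext x i j
  simp [colored]

lemma isHermitian_sqrt : (CFC.sqrt S).IsHermitian := (CFC.sqrt_nonneg S).isSelfAdjoint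

lemma isUnit_det_sqrt (hS : S.PosDef) : IsUnit (CFC.sqrt S).det := by
  have h := CFC.sqrt_mul_sqrt_self S hS.posSemidef.nonneg
  have h2 := congrArg det h
  rw [det_mul] at h2
  exact isUnit_iff_ne_zero.2 fun h0 => hS.det_pos.ne' (by rw [← h2, h0, zero_mul])

lemma design_colored (c : Fin d → EuclideanSpace ℝ (Fin N)) :
    design (colored S c) = (of fun i j => c j i) * CFC.sqrt S := by
  ext i j
  have h (k : Fin d) : CFC.sqrt S j k = CFC.sqrt S k j := by
    simpa using (isHermitian_sqrt (S := S)).apply k j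
  simp [design, colored, mul_apply, mulVec, dotProduct, h, mul_comm]

lemma gram_eq_transpose_mul (c : Fin d → EuclideanSpace ℝ (Fin N)) :
    gram ℝ c = (of fun i j => c j i)ᵀ * (of fun i j => c j i) := by
  ext i j
  simp [gram_apply, mul_apply, PiLp.inner_apply, mul_comm]

lemma transpose_mul_design_colored (c : Fin d → EuclideanSpace ℝ (Fin N)) :
    (design (colored S c))ᵀ * design (colored S c) =
      CFC.sqrt S * gram ℝ c * CFC.sqrt S := by
  have h : (CFC.sqrt S)ᵀ = CFC.sqrt S := by simpa using (isHermitian_sqrt (S := S)).eq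
  rw [design_colored, transpose_mul, h, gram_eq_transpose_mul]
  simp only [Matrix.mul_assoc]

lemma olsMatrix_colored (hS : S.PosDef) (c : Fin d → EuclideanSpace ℝ (Fin N)) :
    olsMatrix (colored S c) = (CFC.sqrt S)⁻¹ * ((gram ℝ c)⁻¹ * (of fun i j => c j i)ᵀ) := by
  have h : (CFC.sqrt S)ᵀ = CFC.sqrt S := by simpa using (isHermitian_sqrt (S := S)).eq
  rw [olsMatrix, transpose_mul_design_colored, design_colored, transpose_mul, h, Matrix.mul_inv_rev,
    Matrix.mul_inv_rev]
  simp only [Matrix.mul_assoc]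
  rw [nonsing_inv_mul_cancel_left _ _ (isUnit_det_sqrt hS)]

lemma ols_mul_transpose_of_gram {c : Fin d → EuclideanSpace ℝ (Fin N)}
    (hc : LinearIndependent ℝ c) :
    ((gram ℝ c)⁻¹ * (of fun i j => c j i)ᵀ) * ((gram ℝ c)⁻¹ * (of fun i j => c j i)ᵀ)ᵀ =
      (gram ℝ c)⁻¹ := by
  have hsymm : (gram ℝ c)ᵀ = gram ℝ c := by simpa using (isHermitian_gram ℝ c).eq
  have hdet : IsUnit (gram ℝ c).det :=
    isUnit_iff_ne_zero.2 (det_gram_ne_zero_iff_linearIndependent.2 hc)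
  rw [transpose_mul, transpose_transpose, transpose_nonsing_inv, hsymm, Matrix.mul_assoc,
    ← Matrix.mul_assoc (of fun i j => c j i)ᵀ, ← gram_eq_transpose_mul,
    mul_nonsing_inv _ hdet, Matrix.mul_one]

/-- The left side is `tr(S A Aᵀ)` with `A Aᵀ = S^{-1/2} (gram ℝ c)⁻¹ S^{-1/2}`; cyclicity of the
trace cancels `S`. -/
lemma sum_mul_olsMatrix_colored (hS : S.PosDef) {c : Fin d → EuclideanSpace ℝ (Fin N)}
    (hc : LinearIndependent ℝ c) :
    ∑ j, ∑ k, S j k * ∑ i, olsMatrix (colored S c) j i * olsMatrix (colored S c) k i =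
      ((gram ℝ c)⁻¹).trace := by
  have h : (CFC.sqrt S)ᵀ = CFC.sqrt S := by simpa using (isHermitian_sqrt (S := S)).eq
  have h1 : ∑ j, ∑ k, S j k * ∑ i, olsMatrix (colored S c) j i * olsMatrix (colored S c) k i =
      (S * (olsMatrix (colored S c) * (olsMatrix (colored S c))ᵀ)).trace := by
    simp only [trace, diag_apply, mul_apply, transpose_apply]
    simp only [mul_comm]
  rw [h1, olsMatrix_colored hS, transpose_mul, Matrix.mul_assoc,
    ← Matrix.mul_assoc ((gram ℝ c)⁻¹ * _), ols_mul_transpose_of_gram hc, transpose_nonsing_inv, h]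
  have h2 : S * ((CFC.sqrt S)⁻¹ * ((gram ℝ c)⁻¹ * (CFC.sqrt S)⁻¹)) =
      CFC.sqrt S * ((gram ℝ c)⁻¹ * (CFC.sqrt S)⁻¹) := by
    nth_rewrite 1 [← CFC.sqrt_mul_sqrt_self S hS.posSemidef.nonneg]
    rw [Matrix.mul_assoc, mul_nonsing_inv_cancel_left _ _ (isUnit_det_sqrt hS)]
  rw [h2, trace_mul_comm, Matrix.mul_assoc, nonsing_inv_mul _ (isUnit_det_sqrt hS),
    Matrix.mul_one]

/-- The squares along row `j` sum to `(gram ℝ c)⁻¹ j j`, which is integrable and dominates each of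
them. -/
lemma memLp_inv_gram_mul_apply (hN : d + 1 < N) (j : Fin d) (i : Fin N) :
    MemLp (fun c : Fin d → EuclideanSpace ℝ (Fin N) =>
      ((gram ℝ c)⁻¹ * (of fun i j => c j i)ᵀ) j i) 2
      (Measure.pi fun _ : Fin d => stdGaussian (EuclideanSpace ℝ (Fin N))) := by
  have hmeas : Measurable fun c : Fin d → EuclideanSpace ℝ (Fin N) =>
      ((gram ℝ c)⁻¹ * (of fun i j => c j i)ᵀ) j i := by
    simp only [mul_apply, transpose_apply, of_apply]
    exact Finset.measurable_sum _ fun k _ =>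
      (measurable_inv_apply (fun a b => by simp only [gram_apply]; fun_prop) j k).mul (by fun_prop)
  rw [memLp_two_iff_integrable_sq hmeas.aestronglyMeasurable]
  refine ((integral_trace_inv_gram_stdGaussian (E := EuclideanSpace ℝ (Fin N)) (d := d)
    (by simpa using hN)).1 j).mono' (hmeas.pow_const 2).aestronglyMeasurable ?_
  filter_upwards [ae_linearIndependent_stdGaussian (E := EuclideanSpace ℝ (Fin N)) (n := d)
    (by rw [finrank_euclideanSpace_fin]; omega)] with c hc
  have h := congrFun (congrFun (ols_mul_transpose_of_gram hc) j) j
  rw [mul_apply] at h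
  rw [← h, Real.norm_eq_abs, abs_sq, sq]
  exact Finset.single_le_sum (f := fun i => ((gram ℝ c)⁻¹ * (of fun i j => c j i)ᵀ) j i *
    ((gram ℝ c)⁻¹ * (of fun i j => c j i)ᵀ)ᵀ i j) (fun i _ => mul_self_nonneg _)
    (Finset.mem_univ i)

lemma ae_det_transpose_mul_design_ne_zero (hS : S.PosDef) (hN : d ≤ N) :
    ∀ᵐ X ∂(Measure.pi fun _ : Fin N => multivariateGaussian 0 S),
      ((design X)ᵀ * design X).det ≠ 0 := by
  rw [← map_colored_pi_stdGaussian, ae_map_iff measurable_colored.aemeasurable]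
  · filter_upwards [ae_linearIndependent_stdGaussian (E := EuclideanSpace ℝ (Fin N)) (n := d)
      (by simpa using hN)] with c hc
    rw [transpose_mul_design_colored, det_mul, det_mul]
    have h := (isUnit_det_sqrt hS).ne_zero
    exact mul_ne_zero (mul_ne_zero h (det_gram_ne_zero_iff_linearIndependent.2 hc)) h
  · refine (measurableSet_singleton (0 : ℝ)).compl.preimage (measurable_det fun i j => ?_)
    simp only [mul_apply, transpose_apply, design, of_apply]
    fun_prop

lemma memLp_olsMatrix (hS : S.PosDef) (hN : d + 1 < N) (j : Fin d) (i : Fin N) :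
    MemLp (fun X => olsMatrix X j i) 2
      (Measure.pi fun _ : Fin N => multivariateGaussian 0 S) := by
  rw [← map_colored_pi_stdGaussian, memLp_map_measure_iff
    (measurable_olsMatrix_apply j i).aestronglyMeasurable measurable_colored.aemeasurable]
  have h (c : Fin d → EuclideanSpace ℝ (Fin N)) : olsMatrix (colored S c) j i =
      ∑ k, (CFC.sqrt S)⁻¹ j k * ((gram ℝ c)⁻¹ * (of fun i j => c j i)ᵀ) k i := by
    rw [olsMatrix_colored hS, mul_apply]
  simp only [Function.comp_def, h]
  exact memLp_finsetSum _ fun k _ => (memLp_inv_gram_mul_apply hN k i).const_mul _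

/-- The covariance-weighted squared size of the least squares matrix of a Gaussian design. -/
lemma sum_mul_integral_olsMatrix (hS : S.PosDef) (hN : d + 1 < N) :
    ∑ j, ∑ k, S j k * ∑ i, ∫ X, olsMatrix X j i * olsMatrix X k i
      ∂(Measure.pi fun _ : Fin N => multivariateGaussian 0 S) = d / ((N : ℝ) - d - 1) := by
  have hint (j k i) : Integrable (fun X => olsMatrix X j i * olsMatrix X k i)
      (Measure.pi fun _ : Fin N => multivariateGaussian 0 S) :=
    (memLp_olsMatrix hS hN j i).integrable_mul (memLp_olsMatrix hS hN k i)
  have h1 := (integral_trace_inv_gram_stdGaussian (E := EuclideanSpace ℝ (Fin N)) (d := d)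
    (by simpa using hN)).2
  rw [finrank_euclideanSpace_fin] at h1
  rw [← h1]
  have h2 : ∑ j, ∑ k, S j k * ∑ i, ∫ X, olsMatrix X j i * olsMatrix X k i
      ∂(Measure.pi fun _ : Fin N => multivariateGaussian 0 S) =
      ∫ X, ∑ j, ∑ k, S j k * ∑ i, olsMatrix X j i * olsMatrix X k i
      ∂(Measure.pi fun _ : Fin N => multivariateGaussian 0 S) := by
    have hi (j k) : Integrable (fun X => ∑ i, olsMatrix X j i * olsMatrix X k i)
        (Measure.pi fun _ : Fin N => multivariateGaussian 0 S) :=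
      integrable_finsetSum _ fun i _ => hint j k i
    rw [integral_finsetSum _ fun j _ => integrable_finsetSum _ fun k _ =>
      (hi j k).const_mul (S j k)]
    refine Finset.sum_congr rfl fun j _ => ?_
    rw [integral_finsetSum _ fun k _ => (hi j k).const_mul (S j k)]
    refine Finset.sum_congr rfl fun k _ => ?_
    rw [integral_const_mul, integral_finsetSum _ fun i _ => hint j k i]
  rw [h2, ← map_colored_pi_stdGaussian, integral_map measurable_colored.aemeasurable]
  · refine integral_congr_ae ?_
    filter_upwards [ae_linearIndependent_stdGaussian (E := EuclideanSpace ℝ (Fin N)) (n := d)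
      (by rw [finrank_euclideanSpace_fin]; omega)] with c hc
    exact sum_mul_olsMatrix_colored hS hc
  · have := measurable_olsMatrix_apply (N := N) (d := d)
    exact Measurable.aestronglyMeasurable (by fun_prop)

end RandomDesign

/-! ### Second moments of sums of products of independent factors. -/

section Moments

variable {Ω α β ι : Type*} [MeasurableSpace Ω] [MeasurableSpace α] [MeasurableSpace β] [Fintype ι]
  {P : Measure Ω}

/-- Independence keeps the product in `L²`, where Hölder alone would give only `L¹`. -/
lemma memLp_two_mul_of_indepFun {f g : Ω → ℝ} (hf : MemLp f 2 P) (hg : MemLp g 2 P)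
    (h : IndepFun f g P) : MemLp (fun ω => f ω * g ω) 2 P := by
  refine (memLp_two_iff_integrable_sq
    (hf.aestronglyMeasurable.mul hg.aestronglyMeasurable)).2 ?_
  simp_rw [Pi.mul_apply, mul_pow]
  exact (h.comp (φ := fun x => x ^ 2) (ψ := fun x => x ^ 2) (by fun_prop)
    (by fun_prop)).integrable_mul hf.integrable_sq hg.integrable_sq

section Bilinear

variable {Z : Ω → α} {T : Ω → β} {u u' : ι → α → ℝ} {v : ι → β → ℝ}

lemma memLp_sum_mul (hZT : IndepFun Z T P) (hu : ∀ i, Measurable (u i))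
    (hv : ∀ i, Measurable (v i)) (hu2 : ∀ i, MemLp (fun ω => u i (Z ω)) 2 P)
    (hv2 : ∀ i, MemLp (fun ω => v i (T ω)) 2 P) :
    MemLp (fun ω => ∑ i, u i (Z ω) * v i (T ω)) 2 P :=
  memLp_finsetSum _ fun i _ =>
    memLp_two_mul_of_indepFun (hu2 i) (hv2 i) (hZT.comp (hu i) (hv i))

lemma integral_sum_mul (hZT : IndepFun Z T P)
    (hu : ∀ i, Measurable (u i)) (hv : ∀ i, Measurable (v i))
    (hu2 : ∀ i, MemLp (fun ω => u i (Z ω)) 2 P) (hv2 : ∀ i, MemLp (fun ω => v i (T ω)) 2 P) :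
    ∫ ω, ∑ i, u i (Z ω) * v i (T ω) ∂P = ∑ i, (∫ ω, u i (Z ω) ∂P) * ∫ ω, v i (T ω) ∂P := by
  have hint (i) : Integrable (fun ω => u i (Z ω) * v i (T ω)) P :=
    (hu2 i).integrable_mul (hv2 i)
  rw [integral_finsetSum _ fun i _ => hint i]
  exact Finset.sum_congr rfl fun i _ => (hZT.comp (hu i) (hv i)).integral_fun_mul_eq_mul_integral
    (hu2 i).aestronglyMeasurable (hv2 i).aestronglyMeasurable

/-- Serves for design against label noise, for fresh feature against training data, and, with a
trivial second variable, for the bias. -/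
lemma integral_sum_mul_mul_sum_mul (hZT : IndepFun Z T P)
    (hu : ∀ i, Measurable (u i)) (hu' : ∀ i, Measurable (u' i)) (hv : ∀ i, Measurable (v i))
    (hu2 : ∀ i, MemLp (fun ω => u i (Z ω)) 2 P) (hu'2 : ∀ i, MemLp (fun ω => u' i (Z ω)) 2 P)
    (hv2 : ∀ i, MemLp (fun ω => v i (T ω)) 2 P) :
    ∫ ω, (∑ i, u i (Z ω) * v i (T ω)) * (∑ i, u' i (Z ω) * v i (T ω)) ∂P =
      ∑ i, ∑ k, (∫ ω, u i (Z ω) * u' k (Z ω) ∂P) * ∫ ω, v i (T ω) * v k (T ω) ∂P := by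
  simp_rw [Finset.sum_mul_sum]
  have hmul {u : ι → α → ℝ} (hu : ∀ i, Measurable (u i))
      (hu2 : ∀ i, MemLp (fun ω => u i (Z ω)) 2 P) (i : ι) :
      MemLp (fun ω => u i (Z ω) * v i (T ω)) 2 P :=
    memLp_two_mul_of_indepFun (hu2 i) (hv2 i) (hZT.comp (hu i) (hv i))
  have hint (i k) : Integrable
      (fun ω => u i (Z ω) * v i (T ω) * (u' k (Z ω) * v k (T ω))) P :=
    (hmul hu hu2 i).integrable_mul (hmul hu' hu'2 k)
  rw [integral_finsetSum _ fun i _ => integrable_finsetSum _ fun k _ => hint i k]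
  refine Finset.sum_congr rfl fun i _ => ?_
  rw [integral_finsetSum _ fun k _ => hint i k]
  refine Finset.sum_congr rfl fun k _ => ?_
  simp_rw [mul_mul_mul_comm (u i _)]
  exact (hZT.comp ((hu i).mul (hu' k)) ((hv i).mul (hv k))).integral_fun_mul_eq_mul_integral
    ((hu2 i).integrable_mul (hu'2 k)).aestronglyMeasurable
    ((hv2 i).integrable_mul (hv2 k)).aestronglyMeasurable

end Bilinear

lemma memLp_eval_pi_gaussianReal (v : ℝ≥0) (i : ι) :
    MemLp (fun x => x i) 2 (Measure.pi fun _ : ι => gaussianReal 0 v) :=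
  (IsGaussian.memLp_two_id (μ := gaussianReal 0 v)).comp_measurePreserving
    (measurePreserving_eval (fun _ : ι => gaussianReal 0 v) i)

lemma integral_eval_pi_gaussianReal (v : ℝ≥0) (i : ι) :
    ∫ x, x i ∂(Measure.pi fun _ : ι => gaussianReal 0 v) = 0 := by
  rw [integral_eval]
  simp

lemma integral_sq_gaussianReal (v : ℝ≥0) : ∫ x, x ^ 2 ∂gaussianReal 0 v = v := by
  have h := variance_of_integral_eq_zero (X := id) (μ := gaussianReal 0 v) (by fun_prop)
    (by simp)
  rw [variance_id_gaussianReal] at h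
  simpa using h.symm

lemma integral_mul_eval_pi_gaussianReal [DecidableEq ι] (v : ℝ≥0) (i j : ι) :
    ∫ x, x i * x j ∂(Measure.pi fun _ : ι => gaussianReal 0 v) = if i = j then (v : ℝ) else 0 := by
  split_ifs with hij
  · subst hij
    simp_rw [← sq]
    rw [integral_comp_eval (μ := fun _ : ι => gaussianReal 0 v) (i := i) (f := fun x : ℝ => x ^ 2)
      (by fun_prop), integral_sq_gaussianReal]
  · have h := (iIndepFun_pi (μ := fun _ : ι => gaussianReal 0 v) (X := fun _ x => x)
      (fun _ => by fun_prop)).indepFun hij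
    rw [h.integral_fun_mul_eq_mul_integral (memLp_eval_pi_gaussianReal v i).aestronglyMeasurable
      (memLp_eval_pi_gaussianReal v j).aestronglyMeasurable,
      integral_eval_pi_gaussianReal, zero_mul]

end Moments

/-! ### Mean and covariance of the pooled noise. -/

section Noise

variable {N K : ℕ}

/-- The effective label noise of the weighted problem. -/
noncomputable def pooledNoise (lam : Fin K → ℝ) (ε : (Fin N → ℝ) × (Fin K → Fin N → ℝ))
    (i : Fin N) : ℝ :=
  (1 + ∑ k, lam k)⁻¹ * (ε.1 i + ∑ k, lam k * ε.2 k i)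

lemma measurable_pooledNoise (lam : Fin K → ℝ) (i : Fin N) :
    Measurable fun ε : (Fin N → ℝ) × (Fin K → Fin N → ℝ) => pooledNoise lam ε i := by
  unfold pooledNoise
  fun_prop

variable (σm : ℝ≥0) (σaux : Fin K → ℝ≥0)

lemma memLp_aux_noise (k : Fin K) (i : Fin N) : MemLp (fun ε : Fin K → Fin N → ℝ => ε k i) 2
    (Measure.pi fun k : Fin K => Measure.pi fun _ : Fin N => gaussianReal 0 (σaux k ^ 2)) :=
  (memLp_eval_pi_gaussianReal (σaux k ^ 2) i).comp_measurePreserving (measurePreserving_eval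
    (fun k : Fin K => Measure.pi fun _ : Fin N => gaussianReal 0 (σaux k ^ 2)) k)

lemma integral_comp_aux_noise (k : Fin K) {f : (Fin N → ℝ) → ℝ} (hf : Measurable f) :
    ∫ ε : Fin K → Fin N → ℝ, f (ε k)
      ∂(Measure.pi fun k : Fin K => Measure.pi fun _ : Fin N => gaussianReal 0 (σaux k ^ 2)) =
      ∫ ε, f ε ∂(Measure.pi fun _ : Fin N => gaussianReal 0 (σaux k ^ 2)) :=
  integral_comp_eval
    (μ := fun k : Fin K => Measure.pi fun _ : Fin N => gaussianReal 0 (σaux k ^ 2))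
    hf.aestronglyMeasurable

lemma integral_aux_noise (k : Fin K) (i : Fin N) : ∫ ε : Fin K → Fin N → ℝ, ε k i
    ∂(Measure.pi fun k : Fin K => Measure.pi fun _ : Fin N => gaussianReal 0 (σaux k ^ 2)) = 0 := by
  rw [integral_comp_aux_noise σaux k (f := fun x => x i) (by fun_prop),
    integral_eval_pi_gaussianReal]

lemma integral_mul_aux_noise (k l : Fin K) (i j : Fin N) :
    ∫ ε : Fin K → Fin N → ℝ, ε k i * ε l j
      ∂(Measure.pi fun k : Fin K => Measure.pi fun _ : Fin N => gaussianReal 0 (σaux k ^ 2)) =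
      if k = l then (if i = j then (σaux k : ℝ) ^ 2 else 0) else 0 := by
  split_ifs with hkl hij
  · subst hkl hij
    rw [integral_comp_aux_noise σaux k (f := fun x => x i * x i) (by fun_prop), integral_mul_eval_pi_gaussianReal]
    simp
  · subst hkl
    rw [integral_comp_aux_noise σaux k (f := fun x => x i * x j) (by fun_prop), integral_mul_eval_pi_gaussianReal, if_neg hij]
  · have h := (iIndepFun_pi
      (μ := fun k : Fin K => Measure.pi fun _ : Fin N => gaussianReal 0 (σaux k ^ 2))
      (X := fun _ x => x) (fun _ => by fun_prop)).indepFun hkl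
    have h2 := h.comp (measurable_pi_apply i) (measurable_pi_apply j)
    exact (h2.integral_fun_mul_eq_mul_integral (Measurable.aestronglyMeasurable (by fun_prop))
      (Measurable.aestronglyMeasurable (by fun_prop))).trans
      (by simp [integral_aux_noise])

/-- Joint law of the label noises. -/
noncomputable def noiseLaw (N : ℕ) {K : ℕ} (σm : ℝ≥0) (σaux : Fin K → ℝ≥0) :
    Measure ((Fin N → ℝ) × (Fin K → Fin N → ℝ)) :=
  (Measure.pi fun _ : Fin N => gaussianReal 0 (σm ^ 2)).prod
    (Measure.pi fun k : Fin K => Measure.pi fun _ : Fin N => gaussianReal 0 (σaux k ^ 2))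

instance : IsProbabilityMeasure (noiseLaw N σm σaux) := by
  unfold noiseLaw
  infer_instance

lemma memLp_main_noise (i : Fin N) : MemLp (fun ε => ε.1 i) 2 (noiseLaw N σm σaux) :=
  (memLp_eval_pi_gaussianReal (σm ^ 2) i).comp_measurePreserving measurePreserving_fst

lemma memLp_snd_noise (k : Fin K) (i : Fin N) :
    MemLp (fun ε => ε.2 k i) 2 (noiseLaw N σm σaux) :=
  (memLp_aux_noise σaux k i).comp_measurePreserving measurePreserving_snd

lemma memLp_pooledNoise (lam : Fin K → ℝ) (i : Fin N) :
    MemLp (fun ε => pooledNoise lam ε i) 2 (noiseLaw N σm σaux) :=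
  ((memLp_main_noise σm σaux i).add (memLp_finsetSum _ fun k _ =>
    (memLp_snd_noise σm σaux k i).const_mul (lam k))).const_mul _

lemma integral_pooledNoise (lam : Fin K → ℝ) (i : Fin N) :
    ∫ ε, pooledNoise lam ε i ∂(noiseLaw N σm σaux) = 0 := by
  have h1 : ∫ ε, ε.1 i ∂(noiseLaw N σm σaux) = 0 := by
    rw [noiseLaw, integral_fun_fst (fun ε : Fin N → ℝ => ε i), integral_eval_pi_gaussianReal]
    simp
  have h2 (k) : ∫ ε, ε.2 k i ∂(noiseLaw N σm σaux) = 0 := by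
    rw [noiseLaw, integral_fun_snd (fun ε : Fin K → Fin N → ℝ => ε k i), integral_aux_noise]
    simp
  have hi (k) := ((memLp_snd_noise σm σaux k i).integrable one_le_two).const_mul (lam k)
  simp only [pooledNoise]
  rw [integral_const_mul, integral_add ((memLp_main_noise σm σaux i).integrable one_le_two)
    (integrable_finsetSum _ fun k _ => hi k), integral_finsetSum _ fun k _ => hi k, h1]
  simp [integral_const_mul, h2]

/-- Products across tasks or across samples have mean zero, so only the squared weights times the
task variances survive, on the diagonal. -/
lemma integral_mul_pooledNoise (lam : Fin K → ℝ) (i j : Fin N) :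
    ∫ ε, pooledNoise lam ε i * pooledNoise lam ε j ∂(noiseLaw N σm σaux) =
      if i = j then ((σm : ℝ) ^ 2 + ∑ k, lam k ^ 2 * (σaux k : ℝ) ^ 2) / (1 + ∑ k, lam k) ^ 2
      else 0 := by
  have h1 (i j) : ∫ ε, ε.1 i * ε.1 j ∂(noiseLaw N σm σaux) =
      if i = j then (σm : ℝ) ^ 2 else 0 := by
    rw [noiseLaw, integral_fun_fst (fun ε : Fin N → ℝ => ε i * ε j),
      integral_mul_eval_pi_gaussianReal]
    simp
  have h2 (k l i j) : ∫ ε, ε.2 k i * ε.2 l j ∂(noiseLaw N σm σaux) =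
      if k = l then (if i = j then (σaux k : ℝ) ^ 2 else 0) else 0 := by
    rw [noiseLaw, integral_fun_snd (fun ε : Fin K → Fin N → ℝ => ε k i * ε l j),
      integral_mul_aux_noise]
    simp
  have h3 (k i j) : ∫ ε, ε.1 i * ε.2 k j ∂(noiseLaw N σm σaux) = 0 := by
    rw [noiseLaw, integral_prod_mul (fun ε : Fin N → ℝ => ε i)
      (fun ε : Fin K → Fin N → ℝ => ε k j), integral_eval_pi_gaussianReal, zero_mul]
  have i1 (i j) : Integrable (fun ε => ε.1 i * ε.1 j) (noiseLaw N σm σaux) :=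
    (memLp_main_noise σm σaux i).integrable_mul (memLp_main_noise σm σaux j)
  have i2 (k l i j) : Integrable (fun ε => ε.2 k i * ε.2 l j) (noiseLaw N σm σaux) :=
    (memLp_snd_noise σm σaux k i).integrable_mul (memLp_snd_noise σm σaux l j)
  have i3 (k i j) : Integrable (fun ε => ε.1 i * ε.2 k j) (noiseLaw N σm σaux) :=
    (memLp_main_noise σm σaux i).integrable_mul (memLp_snd_noise σm σaux k j)
  have hexp (ε : (Fin N → ℝ) × (Fin K → Fin N → ℝ)) :
      pooledNoise lam ε i * pooledNoise lam ε j = (1 + ∑ k, lam k)⁻¹ ^ 2 *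
        (ε.1 i * ε.1 j + ∑ k, lam k * (ε.1 i * ε.2 k j) + ∑ k, lam k * (ε.1 j * ε.2 k i) +
          ∑ k, ∑ l, lam k * lam l * (ε.2 k i * ε.2 l j)) := by
    have e1 : ∑ k, lam k * (ε.1 i * ε.2 k j) = ε.1 i * ∑ k, lam k * ε.2 k j := by
      rw [Finset.mul_sum]; exact Finset.sum_congr rfl fun k _ => by ring
    have e2 : ∑ k, lam k * (ε.1 j * ε.2 k i) = ε.1 j * ∑ k, lam k * ε.2 k i := by
      rw [Finset.mul_sum]; exact Finset.sum_congr rfl fun k _ => by ring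
    have e3 : ∑ k, ∑ l, lam k * lam l * (ε.2 k i * ε.2 l j) =
        (∑ k, lam k * ε.2 k i) * ∑ l, lam l * ε.2 l j := by
      rw [Finset.sum_mul_sum]
      exact Finset.sum_congr rfl fun k _ => Finset.sum_congr rfl fun l _ => by ring
    rw [e1, e2, e3, pooledNoise, pooledNoise]
    ring
  have j1 (i j) : Integrable (fun ε => ∑ k, lam k * (ε.1 i * ε.2 k j)) (noiseLaw N σm σaux) :=
    integrable_finsetSum _ fun k _ => (i3 k i j).const_mul _
  have j2 (k) : Integrable (fun ε => ∑ l, lam k * lam l * (ε.2 k i * ε.2 l j))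
      (noiseLaw N σm σaux) := integrable_finsetSum _ fun l _ => (i2 k l i j).const_mul _
  have j3 : Integrable (fun ε => ε.1 i * ε.1 j + ∑ k, lam k * (ε.1 i * ε.2 k j))
      (noiseLaw N σm σaux) := (i1 i j).add (j1 i j)
  have j4 : Integrable (fun ε => ε.1 i * ε.1 j + ∑ k, lam k * (ε.1 i * ε.2 k j) +
      ∑ k, lam k * (ε.1 j * ε.2 k i)) (noiseLaw N σm σaux) := j3.add (j1 j i)
  simp_rw [hexp]
  rw [integral_const_mul, integral_add j4 (integrable_finsetSum _ fun k _ => j2 k),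
    integral_add j3 (j1 j i),
    integral_add (i1 i j) (j1 i j), integral_finsetSum _ fun k _ => (i3 k i j).const_mul _,
    integral_finsetSum _ fun k _ => (i3 k j i).const_mul _, integral_finsetSum _ fun k _ => j2 k]
  simp_rw [integral_finsetSum _ fun l _ => (i2 _ l i j).const_mul _, integral_const_mul, h1, h2, h3]
  split_ifs with hij
  · simp [div_eq_inv_mul, sq]
  · simp

end Noise

/-! ### The centred estimator and the quadratic form of the covariance. -/

section Estimator

variable {N d K : ℕ} {S : Matrix (Fin d) (Fin d) ℝ}

/-- The centred estimator `(XᵀX)⁻¹Xᵀη`, with `η` the pooled noise. -/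
noncomputable def estimatorError (lam : Fin K → ℝ)
    (D : ((Fin N → EuclideanSpace ℝ (Fin d)) × (Fin N → ℝ)) × (Fin K → Fin N → ℝ)) :
    EuclideanSpace ℝ (Fin d) :=
  WithLp.toLp 2 fun j => ∑ i, olsMatrix D.1.1 j i * pooledNoise lam (D.1.2, D.2) i

lemma measurable_estimatorError (lam : Fin K → ℝ) :
    Measurable (estimatorError (N := N) (d := d) lam) := by
  refine (WithLp.measurable_toLp 2 _).comp (measurable_pi_lambda _ fun j =>
    Finset.measurable_fun_sum _ fun i _ => ?_)
  exact ((measurable_olsMatrix_apply (N := N) j i).comp (measurable_fst.comp measurable_fst)).mul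
    ((measurable_pooledNoise lam i).comp
      ((measurable_snd.comp measurable_fst).prodMk measurable_snd))

lemma memLp_eval_multivariateGaussian (j : Fin d) :
    MemLp (fun x => x j) 2 (multivariateGaussian 0 S) :=
  (IsGaussian.memLp_two_id (μ := multivariateGaussian 0 S)).eval_piLp j

lemma integral_mul_eval_multivariateGaussian (hS : S.PosSemidef) (j k : Fin d) :
    ∫ x, x j * x k ∂(multivariateGaussian 0 S) = S j k := by
  have h0 (j : Fin d) : ∫ x, x j ∂(multivariateGaussian 0 S) = 0 := by
    rw [← eval_integral_piLp fun j =>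
      (memLp_eval_multivariateGaussian (S := S) j).integrable one_le_two,
      integral_id_multivariateGaussian]
    rfl
  rw [← covariance_eval_multivariateGaussian (μ := 0) hS j k, covariance_eq_sub
    (memLp_eval_multivariateGaussian j) (memLp_eval_multivariateGaussian k), h0]
  simp

lemma norm_sqrtApply_sq (hS : S.PosSemidef) (v : EuclideanSpace ℝ (Fin d)) :
    ‖sqrtApply S v‖ ^ 2 = ∑ j, ∑ k, S j k * (v j * v k) := by
  have h : (CFC.sqrt S).transpose = CFC.sqrt S := by simpa using (isHermitian_sqrt (S := S)).eq
  have h1 : ‖sqrtApply S v‖ ^ 2 = Matrix.mulVec (CFC.sqrt S) v ⬝ᵥ Matrix.mulVec (CFC.sqrt S) v := by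
    rw [EuclideanSpace.real_norm_sq_eq]
    simp [sqrtApply, dotProduct, sq]
  rw [h1, Matrix.dotProduct_mulVec, ← Matrix.mulVec_transpose, h, Matrix.mulVec_mulVec,
    CFC.sqrt_mul_sqrt_self S hS.nonneg, dotProduct]
  simp only [Matrix.mulVec, dotProduct, Finset.sum_mul]
  exact Finset.sum_congr rfl fun j _ => Finset.sum_congr rfl fun k _ => by ring

end Estimator

/-! ### Independence structure and the bias-variance decomposition. -/

section Risk

variable {Ω : Type*} [MeasurableSpace Ω] {P : Measure Ω}
  {N d K : ℕ} {S : Matrix (Fin d) (Fin d) ℝ} {σm : ℝ≥0} {σaux : Fin K → ℝ≥0} {lam : Fin K → ℝ}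
  {X : Ω → Fin N → EuclideanSpace ℝ (Fin d)} {εm : Ω → Fin N → ℝ} {εaux : Ω → Fin K → Fin N → ℝ}
  {x : Ω → EuclideanSpace ℝ (Fin d)} {e : Ω → ℝ}

lemma indepFun_of_hasLaw_prod [IsFiniteMeasure P] {α β : Type*} [MeasurableSpace α] [MeasurableSpace β]
    {μ : Measure α} {ν : Measure β} [IsProbabilityMeasure μ] [IsProbabilityMeasure ν]
    {f : Ω → α} {g : Ω → β} (h : HasLaw (fun ω => (f ω, g ω)) (μ.prod ν) P) :
    HasLaw f μ P ∧ HasLaw g ν P ∧ IndepFun f g P := by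
  have hf : HasLaw f μ P := measurePreserving_fst.fun_comp_hasLaw h
  have hg : HasLaw g ν P := measurePreserving_snd.fun_comp_hasLaw h
  exact ⟨hf, hg, (indepFun_iff_hasLaw_prodMk_prod hf hg).2 h⟩

/-- The marginal laws and independence relations contained in the joint law. -/
lemma hasLaw_jointLaw_consequences [IsFiniteMeasure P]
    (hlaw : HasLaw (fun ω => (X ω, εm ω, εaux ω, x ω, e ω)) (jointLaw N S σm σaux) P) :
    (HasLaw X (Measure.pi fun _ : Fin N => multivariateGaussian 0 S) P ∧
      HasLaw (fun ω => (εm ω, εaux ω)) (noiseLaw N σm σaux) P ∧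
      IndepFun X (fun ω => (εm ω, εaux ω)) P) ∧
    (HasLaw x (multivariateGaussian 0 S) P ∧ HasLaw e (gaussianReal 0 (σm ^ 2)) P ∧
      IndepFun (fun ω => ((X ω, εm ω), εaux ω)) x P ∧
      IndepFun (fun ω => (((X ω, εm ω), εaux ω), x ω)) e P) := by
  -- The joint law is nested to the right; three reassociations nest it to the left, so that the
  -- fresh noise and then the fresh feature split off.
  have h1 := (measurePreserving_prodAssoc _ _ _).symm.fun_comp_hasLaw hlaw
  have h2 := (measurePreserving_prodAssoc _ _ _).symm.fun_comp_hasLaw h1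
  have h3 := (measurePreserving_prodAssoc _ _ _).symm.fun_comp_hasLaw h2
  obtain ⟨h4, he, hDxe⟩ := indepFun_of_hasLaw_prod
    (f := fun ω => (((X ω, εm ω), εaux ω), x ω)) (g := e) h3
  obtain ⟨h5, hx, hDx⟩ := indepFun_of_hasLaw_prod h4
  have h6 := (measurePreserving_prodAssoc _ _ _).fun_comp_hasLaw h5
  obtain ⟨hX, hε, hXε⟩ := indepFun_of_hasLaw_prod (f := X) (g := fun ω => (εm ω, εaux ω)) h6
  exact ⟨⟨hX, hε, hXε⟩, hx, he, hDx, hDxe⟩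

lemma memLp_comp_of_hasLaw {α : Type*} [MeasurableSpace α] {μ : Measure α} {Z : Ω → α} {f : α → ℝ}
    (hZ : HasLaw Z μ P) (hf : MemLp f 2 μ) : MemLp (fun ω => f (Z ω)) 2 P := by
  have := hZ.map_eq ▸ hf
  exact (memLp_map_measure_iff this.aestronglyMeasurable hZ.aemeasurable).1 this

/-- Independence of `A` and `η` gives `𝔼[A η (A η)ᵀ] = τ 𝔼[A Aᵀ]`, which is then weighted by `S`. -/
lemma estimatorError_moments (hS : S.PosDef) (hN : d + 1 < N)
    (hX : HasLaw X (Measure.pi fun _ : Fin N => multivariateGaussian 0 S) P)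
    (hε : HasLaw (fun ω => (εm ω, εaux ω)) (noiseLaw N σm σaux) P)
    (hXε : IndepFun X (fun ω => (εm ω, εaux ω)) P) :
    (∀ j, MemLp (fun ω => estimatorError lam ((X ω, εm ω), εaux ω) j) 2 P) ∧
    (∀ j, ∫ ω, estimatorError lam ((X ω, εm ω), εaux ω) j ∂P = 0) ∧
    ∑ j, ∑ k, S j k * ∫ ω, estimatorError lam ((X ω, εm ω), εaux ω) j *
        estimatorError lam ((X ω, εm ω), εaux ω) k ∂P =
      ((σm : ℝ) ^ 2 + ∑ k, lam k ^ 2 * (σaux k : ℝ) ^ 2) / (1 + ∑ k, lam k) ^ 2 *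
        (d / ((N : ℝ) - d - 1)) := by
  set τ : ℝ := ((σm : ℝ) ^ 2 + ∑ k, lam k ^ 2 * (σaux k : ℝ) ^ 2) / (1 + ∑ k, lam k) ^ 2 with hτ
  have hu (j : Fin d) (i : Fin N) := measurable_olsMatrix_apply (N := N) j i
  have hv (i : Fin N) := measurable_pooledNoise (N := N) lam i
  have hu2 (j : Fin d) (i : Fin N) := memLp_comp_of_hasLaw hX (memLp_olsMatrix hS hN j i)
  have hv2 (i : Fin N) := memLp_comp_of_hasLaw hε (memLp_pooledNoise σm σaux lam i)
  have hη (i : Fin N) : ∫ ω, pooledNoise lam (εm ω, εaux ω) i ∂P = 0 := by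
    rw [← integral_pooledNoise σm σaux lam i]
    exact hε.integral_comp (hv i).aestronglyMeasurable
  have hηη (i j : Fin N) : ∫ ω, pooledNoise lam (εm ω, εaux ω) i *
      pooledNoise lam (εm ω, εaux ω) j ∂P = if i = j then τ else 0 := by
    rw [hτ, ← integral_mul_pooledNoise σm σaux lam i j]
    exact hε.integral_comp ((hv i).mul (hv j)).aestronglyMeasurable
  have hAA (j k : Fin d) (i : Fin N) : ∫ ω, olsMatrix (X ω) j i * olsMatrix (X ω) k i ∂P =
      ∫ X, olsMatrix X j i * olsMatrix X k i
        ∂(Measure.pi fun _ : Fin N => multivariateGaussian 0 S) :=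
    hX.integral_comp ((hu j i).mul (hu k i)).aestronglyMeasurable
  refine ⟨fun j => memLp_sum_mul hXε (hu j) hv (hu2 j) hv2, fun j => ?_, ?_⟩
  · refine (integral_sum_mul hXε (hu j) hv (hu2 j) hv2).trans ?_
    simp [hη]
  · have hGG (j k : Fin d) : ∫ ω, estimatorError lam ((X ω, εm ω), εaux ω) j *
        estimatorError lam ((X ω, εm ω), εaux ω) k ∂P = τ * ∑ i, ∫ X,
          olsMatrix X j i * olsMatrix X k i
          ∂(Measure.pi fun _ : Fin N => multivariateGaussian 0 S) := by
      refine (integral_sum_mul_mul_sum_mul hXε (hu j) (hu k) hv (hu2 j) (hu2 k) hv2).trans ?_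
      simp [hηη, hAA, Finset.mul_sum, mul_comm]
    rw [← sum_mul_integral_olsMatrix hS hN]
    simp_rw [hGG]
    rw [Finset.mul_sum]
    refine Finset.sum_congr rfl fun j _ => ?_
    rw [Finset.mul_sum]
    exact Finset.sum_congr rfl fun k _ => by ring

lemma integral_sq_add_sub {a b c : Ω → ℝ} (ha : MemLp a 2 P) (hb : MemLp b 2 P)
    (hc : MemLp c 2 P) (hab : ∫ ω, a ω * b ω ∂P = 0) (habc : ∫ ω, (a ω + b ω) * c ω ∂P = 0) :
    ∫ ω, (a ω + b ω - c ω) ^ 2 ∂P =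
      ∫ ω, a ω ^ 2 ∂P + ∫ ω, b ω ^ 2 ∂P + ∫ ω, c ω ^ 2 ∂P := by
  have i1 := ha.integrable_sq
  have i2 := hb.integrable_sq
  have i3 := hc.integrable_sq
  have i4 : Integrable (fun ω => a ω * b ω) P := ha.integrable_mul hb
  have i5 : Integrable (fun ω => (a ω + b ω) * c ω) P := (ha.add hb).integrable_mul hc
  have i6 : Integrable (fun ω => a ω ^ 2 + b ω ^ 2) P := i1.add i2
  have i7 : Integrable (fun ω => a ω ^ 2 + b ω ^ 2 + c ω ^ 2) P := i6.add i3
  have i8 : Integrable (fun ω => a ω ^ 2 + b ω ^ 2 + c ω ^ 2 + 2 * (a ω * b ω)) P :=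
    i7.add (i4.const_mul 2)
  have hexp (ω) : (a ω + b ω - c ω) ^ 2 =
      a ω ^ 2 + b ω ^ 2 + c ω ^ 2 + 2 * (a ω * b ω) - 2 * ((a ω + b ω) * c ω) := by ring
  simp_rw [hexp]
  rw [integral_sub i8 (i5.const_mul 2), integral_add i7 (i4.const_mul 2), integral_add i6 i3,
    integral_add i1 i2, integral_const_mul, integral_const_mul, hab, habc]
  ring

/-- Bias-variance decomposition for a centred error independent of the fresh sample. -/
lemma risk_decomposition [IsProbabilityMeasure P] {α : Type*} [MeasurableSpace α] (hS : S.PosSemidef) {D : Ω → α}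
    {g : α → EuclideanSpace ℝ (Fin d)} (hgm : Measurable g)
    (hg2 : ∀ j, MemLp (fun ω => g (D ω) j) 2 P) (hg0 : ∀ j, ∫ ω, g (D ω) j ∂P = 0)
    (hx : HasLaw x (multivariateGaussian 0 S) P) (he : HasLaw e (gaussianReal 0 (σm ^ 2)) P)
    (hDx : IndepFun D x P) (hDxe : IndepFun (fun ω => (D ω, x ω)) e P)
    (v : EuclideanSpace ℝ (Fin d)) :
    MemLp (fun ω => ⟪x ω, g (D ω)⟫) 2 P ∧
    ∫ ω, ⟪x ω, g (D ω)⟫ ^ 2 ∂P = ∑ j, ∑ k, S j k * ∫ ω, g (D ω) j * g (D ω) k ∂P ∧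
    ∫ ω, ⟪x ω, v⟫ ^ 2 ∂P = ‖sqrtApply S v‖ ^ 2 ∧
    ∫ ω, e ω ^ 2 ∂P = (σm : ℝ) ^ 2 ∧
    Integrable (fun ω => (⟪x ω, g (D ω)⟫ + ⟪x ω, v⟫ - e ω) ^ 2) P ∧
    ∫ ω, (⟪x ω, g (D ω)⟫ + ⟪x ω, v⟫ - e ω) ^ 2 ∂P =
      ∫ ω, ⟪x ω, g (D ω)⟫ ^ 2 ∂P + ∫ ω, ⟪x ω, v⟫ ^ 2 ∂P + ∫ ω, e ω ^ 2 ∂P := by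
  have hin (a b : EuclideanSpace ℝ (Fin d)) : ⟪a, b⟫ = ∑ j, a j * b j := by
    simp [PiLp.inner_apply, mul_comm]
  have hg (j : Fin d) : Measurable fun a => g a j := by fun_prop
  have hu (j : Fin d) : Measurable fun x : EuclideanSpace ℝ (Fin d) => x j := by fun_prop
  have hx2 (j : Fin d) : MemLp (fun ω => x ω j) 2 P :=
    memLp_comp_of_hasLaw hx (memLp_eval_multivariateGaussian j)
  have hxx (j k : Fin d) : ∫ ω, x ω j * x ω k ∂P = S j k := by
    rw [← integral_mul_eval_multivariateGaussian hS j k]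
    exact hx.integral_comp ((hu j).mul (hu k)).aestronglyMeasurable
  have he2 : MemLp e 2 P := memLp_comp_of_hasLaw (f := id) he IsGaussian.memLp_two_id
  have he0 : ∫ ω, e ω ∂P = 0 := by
    rw [he.integral_eq]; simp
  have hee : ∫ ω, e ω ^ 2 ∂P = (σm : ℝ) ^ 2 := by
    have := integral_sq_gaussianReal (σm ^ 2)
    rw [← show _ = _ from he.integral_comp (f := fun x : ℝ => x ^ 2) (by fun_prop)] at this
    simpa using this
  have hvar2 : MemLp (fun ω => ⟪x ω, g (D ω)⟫) 2 P := by
    simp_rw [hin]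
    exact memLp_sum_mul (u := fun j (x : EuclideanSpace ℝ (Fin d)) => x j)
      (v := fun j a => g a j) hDx.symm hu hg hx2 hg2
  have hb2 : MemLp (fun ω => ⟪x ω, v⟫) 2 P := by
    simp_rw [hin]
    exact memLp_finsetSum _ fun j _ => (hx2 j).mul_const _
  have hvar : ∫ ω, ⟪x ω, g (D ω)⟫ ^ 2 ∂P =
      ∑ j, ∑ k, S j k * ∫ ω, g (D ω) j * g (D ω) k ∂P := by
    simp_rw [hin, sq, ← hxx]
    exact integral_sum_mul_mul_sum_mul
      (u := fun j (x : EuclideanSpace ℝ (Fin d)) => x j)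
      (u' := fun j (x : EuclideanSpace ℝ (Fin d)) => x j)
      (v := fun j a => g a j) hDx.symm hu hu hg hx2 hx2 hg2
  have hbias : ∫ ω, ⟪x ω, v⟫ ^ 2 ∂P = ‖sqrtApply S v‖ ^ 2 := by
    rw [norm_sqrtApply_sq hS]
    simp_rw [hin, sq, ← hxx]
    -- The fixed vector `v` is viewed as a function of a constant variable, which is independent of
    -- `x`.
    refine (integral_sum_mul_mul_sum_mul
      (u := fun j (x : EuclideanSpace ℝ (Fin d)) => x j)
      (u' := fun j (x : EuclideanSpace ℝ (Fin d)) => x j) (T := fun _ => ())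
      (v := fun j _ => v j) (indepFun_const_right x ()) hu hu (fun _ => measurable_const) hx2 hx2
      (fun _ => memLp_const _)).trans ?_
    simp
  -- Each summand is grouped as a function of `x` times a coordinate of the centred error; the first
  -- factor is only known to be in `L¹`, so independence is applied termwise.
  have hcross : ∫ ω, ⟪x ω, g (D ω)⟫ * ⟪x ω, v⟫ ∂P = 0 := by
    have h (ω) : ⟪x ω, g (D ω)⟫ * ⟪x ω, v⟫ = ∑ j, (x ω j * ⟪x ω, v⟫) * g (D ω) j := by
      rw [hin, Finset.sum_mul]
      exact Finset.sum_congr rfl fun j _ => by ring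
    have hind (j) : IndepFun (fun ω => x ω j * ⟪x ω, v⟫) (fun ω => g (D ω) j) P :=
      hDx.symm.comp (φ := fun x : EuclideanSpace ℝ (Fin d) => x j * ⟪x, v⟫) (by fun_prop) (hg j)
    have hi (j) : Integrable (fun ω => x ω j * ⟪x ω, v⟫) P := (hx2 j).integrable_mul hb2
    have hi' (j) : Integrable (fun ω => x ω j * ⟪x ω, v⟫ * g (D ω) j) P :=
      (hind j).integrable_mul (hi j) ((hg2 j).integrable one_le_two)
    simp_rw [h]
    rw [integral_finsetSum _ fun j _ => hi' j]
    refine Finset.sum_eq_zero fun j _ => ?_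
    rw [(hind j).integral_fun_mul_eq_mul_integral (hi j).aestronglyMeasurable
      (hg2 j).aestronglyMeasurable, hg0, mul_zero]
  have hs2 : MemLp (fun ω => ⟪x ω, g (D ω)⟫ + ⟪x ω, v⟫) 2 P := hvar2.add hb2
  have hcross' : ∫ ω, (⟪x ω, g (D ω)⟫ + ⟪x ω, v⟫) * e ω ∂P = 0 := by
    have hind : IndepFun (fun ω => ⟪x ω, g (D ω)⟫ + ⟪x ω, v⟫) e P := by
      refine hDxe.comp (φ := fun p : α × EuclideanSpace ℝ (Fin d) => ⟪p.2, g p.1⟫ + ⟪p.2, v⟫)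
        (ψ := id) ?_ measurable_id
      fun_prop
    rw [hind.integral_fun_mul_eq_mul_integral hs2.aestronglyMeasurable he2.aestronglyMeasurable,
      he0, mul_zero]
  exact ⟨hvar2, hvar, hbias, hee, (hs2.sub he2).integrable_sq,
    integral_sq_add_sub hvar2 hb2 he2 hcross hcross'⟩

end Risk

end AuxOLS

/-! ### Assembly for an arbitrary minimizing estimator. -/

theorem theorem3p1 {Ω : Type*} [MeasurableSpace Ω] (P : Measure Ω) [IsProbabilityMeasure P]
    (N d K : ℕ) (hN : d + 1 < N)
    (S : Matrix (Fin d) (Fin d) ℝ) (hS : S.PosDef)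
    (wm : EuclideanSpace ℝ (Fin d)) (waux : Fin K → EuclideanSpace ℝ (Fin d))
    (σm : ℝ≥0) (σaux : Fin K → ℝ≥0)
    (lam : Fin K → ℝ) (hlam : ∀ k, 0 ≤ lam k)
    -- features, label noises, fresh feature and fresh noise
    (X : Ω → Fin N → EuclideanSpace ℝ (Fin d))
    (εm : Ω → Fin N → ℝ) (εaux : Ω → Fin K → Fin N → ℝ)
    (x : Ω → EuclideanSpace ℝ (Fin d)) (e : Ω → ℝ)
    (hlaw : HasLaw (fun ω => (X ω, εm ω, εaux ω, x ω, e ω)) (AuxOLS.jointLaw N S σm σaux) P)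
    -- the fresh main-task label
    (y : Ω → ℝ) (hy : ∀ ω, y ω = ⟪x ω, wm⟫ + e ω)
    -- the estimator almost surely minimizes the weighted loss of the training set
    (what : Ω → EuclideanSpace ℝ (Fin d))
    (hwhat : ∀ᵐ ω ∂P, IsMinOn
      (AuxOLS.loss lam (AuxOLS.generate wm waux (X ω) (εm ω) (εaux ω))) Set.univ (what ω))
    (L : ℝ) (hL : L = ∑ k, lam k) :
    Integrable what P ∧
    Integrable (fun ω => (⟪x ω, what ω⟫ - y ω) ^ 2) P ∧
    Integrable (fun ω => ⟪x ω, what ω - ∫ ω', what ω' ∂P⟫ ^ 2) P ∧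
    AuxOLS.genError P what x y =
      AuxOLS.varianceTerm P what x + AuxOLS.biasTerm P what x wm + AuxOLS.noiseTerm P x y wm ∧
    (0 < L →
      AuxOLS.varianceTerm P what x =
        ((σm : ℝ) ^ 2 + ∑ k, lam k ^ 2 * (σaux k : ℝ) ^ 2) / (1 + L) ^ 2 *
          ((d : ℝ) / ((N : ℝ) - d - 1)) ∧
      AuxOLS.biasTerm P what x wm =
        (L / (1 + L)) ^ 2 *
          ‖AuxOLS.sqrtApply S ((1 / L) • (∑ k, lam k • waux k) - wm)‖ ^ 2 ∧
      AuxOLS.noiseTerm P x y wm = (σm : ℝ) ^ 2 ∧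
      AuxOLS.genError P what x y =
        ((σm : ℝ) ^ 2 + ∑ k, lam k ^ 2 * (σaux k : ℝ) ^ 2) / (1 + L) ^ 2 *
            ((d : ℝ) / ((N : ℝ) - d - 1)) +
          (L / (1 + L)) ^ 2 *
            ‖AuxOLS.sqrtApply S ((1 / L) • (∑ k, lam k • waux k) - wm)‖ ^ 2 +
          (σm : ℝ) ^ 2) ∧
    (K = 0 ∨ L = 0 →
      AuxOLS.varianceTerm P what x = (σm : ℝ) ^ 2 * ((d : ℝ) / ((N : ℝ) - d - 1)) ∧
      AuxOLS.biasTerm P what x wm = 0 ∧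
      AuxOLS.noiseTerm P x y wm = (σm : ℝ) ^ 2 ∧
      AuxOLS.genError P what x y =
        (σm : ℝ) ^ 2 * ((d : ℝ) / ((N : ℝ) - d - 1)) + (σm : ℝ) ^ 2) := by
  have hLnn : 0 ≤ L := hL ▸ Finset.sum_nonneg fun k _ => hlam k
  have hL1 : 1 + L ≠ 0 := by positivity
  obtain ⟨⟨hX, hε, hXε⟩, hx, he, hDx, hDxe⟩ := AuxOLS.hasLaw_jointLaw_consequences hlaw
  obtain ⟨hG2, hG0, hGG⟩ := AuxOLS.estimatorError_moments (lam := lam) hS hN hX hε hXε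
  set w0 : EuclideanSpace ℝ (Fin d) := (1 + L)⁻¹ • (wm + ∑ k, lam k • waux k) with hw0
  set G : Ω → EuclideanSpace ℝ (Fin d) :=
    fun ω => AuxOLS.estimatorError lam ((X ω, εm ω), εaux ω) with hG
  obtain ⟨hvar2, hvar, hbias, hnoise, hint, hdecomp⟩ := AuxOLS.risk_decomposition hS.posSemidef
    (AuxOLS.measurable_estimatorError lam) hG2 hG0 hx he hDx hDxe (w0 - wm)
  rw [hGG, ← hL] at hvar
  -- The minimizer is almost surely unique and explicit; this also provides the measurability of
  -- `what`, which is not assumed.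
  have hae : ∀ᵐ ω ∂P, what ω = w0 + G ω := by
    have hdet := AuxOLS.ae_det_transpose_mul_design_ne_zero hS (by omega : d ≤ N)
    rw [← hX.map_eq] at hdet
    filter_upwards [hwhat, ae_of_ae_map hX.aemeasurable hdet] with ω hmin hω
    ext j
    have := AuxOLS.isMinOn_loss_generate_apply hlam hω hmin j
    rw [this, hw0, hL]
    rfl
  have hGint : ∀ j, Integrable (fun ω => G ω j) P := fun j => (hG2 j).integrable one_le_two
  have hGint' : Integrable G P := Integrable.of_eval_piLp hGint
  have hsum : Integrable (fun ω => w0 + G ω) P := (integrable_const w0).add hGint'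
  have hmean : ∫ ω, what ω ∂P = w0 := by
    rw [integral_congr_ae hae, integral_add (integrable_const _) hGint']
    have : ∫ ω, G ω ∂P = 0 := by
      ext j
      rw [eval_integral_piLp hGint]
      exact hG0 j
    simp [this]
  have hvarae : (fun ω => ⟪x ω, what ω - ∫ ω', what ω' ∂P⟫ ^ 2) =ᵐ[P]
      fun ω => ⟪x ω, G ω⟫ ^ 2 := by
    filter_upwards [hae] with ω hω
    rw [hmean, hω, add_sub_cancel_left]
  have hgenae : (fun ω => (⟪x ω, what ω⟫ - y ω) ^ 2) =ᵐ[P]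
      fun ω => (⟪x ω, G ω⟫ + ⟪x ω, w0 - wm⟫ - e ω) ^ 2 := by
    filter_upwards [hae] with ω hω
    rw [hω, hy, inner_add_right, inner_sub_right]
    ring
  have hV : AuxOLS.varianceTerm P what x =
      ((σm : ℝ) ^ 2 + ∑ k, lam k ^ 2 * (σaux k : ℝ) ^ 2) / (1 + L) ^ 2 *
        ((d : ℝ) / ((N : ℝ) - d - 1)) := (integral_congr_ae hvarae).trans hvar
  have hB : AuxOLS.biasTerm P what x wm = ‖AuxOLS.sqrtApply S (w0 - wm)‖ ^ 2 := by
    rw [AuxOLS.biasTerm, hmean, hbias]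
  have hNo : AuxOLS.noiseTerm P x y wm = (σm : ℝ) ^ 2 := by
    rw [← hnoise, AuxOLS.noiseTerm]
    simp [hy]
  have hE : AuxOLS.genError P what x y = AuxOLS.varianceTerm P what x +
      AuxOLS.biasTerm P what x wm + AuxOLS.noiseTerm P x y wm := by
    rw [hV, hB, hNo, ← hvar, ← hbias, ← hnoise, ← hdecomp]
    exact integral_congr_ae hgenae
  refine ⟨hsum.congr (hae.mono fun ω h => h.symm), hint.congr hgenae.symm,
    hvar2.integrable_sq.congr hvarae.symm, hE, fun hLpos => ?_, fun hL0 => ?_⟩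
  · have hB' : AuxOLS.biasTerm P what x wm = (L / (1 + L)) ^ 2 *
        ‖AuxOLS.sqrtApply S ((1 / L) • (∑ k, lam k • waux k) - wm)‖ ^ 2 := by
      have hw : w0 - wm = (L / (1 + L)) • ((1 / L) • (∑ k, lam k • waux k) - wm) := by
        ext j
        simp only [hw0, PiLp.sub_apply, PiLp.smul_apply, PiLp.add_apply, smul_eq_mul]
        field_simp
        ring
      rw [hB, hw, AuxOLS.sqrtApply, map_smul, norm_smul, mul_pow, Real.norm_eq_abs, sq_abs]
      rfl
    exact ⟨hV, hB', hNo, by rw [hE, hV, hB', hNo]⟩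
  · have hLz : L = 0 := by
      rcases hL0 with rfl | h
      · simpa using hL
      · exact h
    -- A vanishing sum of nonnegative weights has only zero weights, so auxiliary tasks drop out; `K
    -- = 0` was reduced to this case through the empty sum.
    have hlam0 (k) : lam k = 0 :=
      (Finset.sum_eq_zero_iff_of_nonneg fun k _ => hlam k).1 (hL ▸ hLz) k (Finset.mem_univ k)
    have hV' : AuxOLS.varianceTerm P what x = (σm : ℝ) ^ 2 * ((d : ℝ) / ((N : ℝ) - d - 1)) := by
      rw [hV]
      simp [hLz, hlam0]
    have hB' : AuxOLS.biasTerm P what x wm = 0 := by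
      rw [hB, hw0]
      simp [hLz, hlam0, AuxOLS.sqrtApply]
    exact ⟨hV', hB', hNo, by rw [hE, hV', hB', hNo, add_zero]⟩
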